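/- **Lemma 5 (Error bound for MU-MISO).** Let $K\ge 1$, let $\mathbf H=[\mathbf h_1,\dots,\mathbf h_K]\in\mathbb C^{M\times K}$ with $\mathbf H^H\mathbf H$ invertible, $\mathbf x\in\mathbb C^K$, $\beta\ge 0$ (in particular the power normalization factor of the precoder), and $$\mathbf e=(\mathbf H^H\mathbf H)^{-1}\mathbf x,\qquad \mathbf s=\sqrt\beta\,\mathbf H\mathbf e .$$ Let $0<u<1$ be the unit roundoff and $\lambda>0$. The transmit vector is computed by the normal equations method in rounded arithmetic: $\mathbf C^{(l)}=\boldsymbol{fl}(\mathbf H^H\mathbf H)$; Cholesky factorization $\mathbf C^{(l)}=(\mathbf R^{(l)})^H\mathbf R^{(l)}$; solution of the triangular systems $(\mathbf R^{(l)})^H\mathbf q^{(l)}=\mathbf x$ and $\mathbf R^{(l)}\mathbf e^{(l)}=\mathbf q^{(l)}$ by substitution; $\boldsymbol{fl}(\mathbf H\mathbf e^{(l)})$, scaled exactly by $\sqrt\beta$ to give $\mathbf s^{(l)}$. Complex operations are carried out through their real and imaginary parts, and each real elementary operation ($+,-,\times,/,\sqrt{\ }$) returns its exact result times $1+\delta$,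 where the $\delta$'s of the different operations are independent random variables of mean zero with $|\delta|\le u$. Put $\kappa_2(\mathbf A)=\|\mathbf A\|_2\|\mathbf A^{-1}\|_2$, $\kappa_2=\kappa_2(\mathbf H^H\mathbf H)$ and $$\gamma_n=\exp\Big(\lambda\sqrt n\,u+\frac{nu^2}{1-u}\Big)-1,\qquad c_1^{\mathrm d}=c_1^{\mathrm u}=2K\Big(\gamma_{2M}+\frac{\gamma_{6K+1}}{1-2K\gamma_{2K+1}}\Big),$$ $$c^{\mathrm d}=c_1^{\mathrm d}\kappa_2+\sqrt{2K}\,\gamma_{2K}\,(1+c_1^{\mathrm d}\kappa_2).$$ Assume $2K\gamma_{2K+1}<1$, $c_1^{\mathrm d}\kappa_2<1$, and backward stability in the sense that $\|\mathbf H\|_2\|\mathbf e\|_2$ is comparable to $\|\mathbf H\mathbf e\|_2$: $\|\mathbf H\|_2\|\mathbf e\|_2\le\tau\|\mathbf H\mathbf e\|_2$ with some $\tau\ge1$. Then $\mathbf s^{(l)}=\mathbf s+\Delta\mathbf S$ with a random $\Delta\mathbf S\in\mathbb C^M$; for every $\rho\ge0$ and noise $\mathbf n\in\mathbb C^K$ the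 signal $\mathbf y^{(l)}=\sqrt\rho\,\mathbf H^H\mathbf s^{(l)}+\mathbf n$ received by the users is $$y_k^{(l)}=\sqrt{\rho\beta}\,x_k+\sqrt\rho\,\mathbf h_k^H\Delta\mathbf S+n_k\qquad(1\le k\le K);$$ and $$\|\Delta\mathbf S\|_2\le c^{\mathrm d}\|\mathbf s\|_2$$ holds with probability at least $1-C\,MK^2\exp(-c\lambda^2/\tau^2)$, where $C,c>0$ are absolute constants. -/

import Mathlib

open MeasureTheory ProbabilityTheory

noncomputable section

namespace ZFPrecoding

/-! ### Norms, condition number, ideal zero-forcing precoding -/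

/-- Euclidean norm of a complex vector. -/
def vecNorm {n : ℕ} (v : Fin n → ℂ) : ℝ := ‖WithLp.toLp 2 v‖

open scoped Matrix.Norms.L2Operator in
/-- Spectral norm of a complex matrix. -/
def specNorm {m n : ℕ} (A : Matrix (Fin m) (Fin n) ℂ) : ℝ := ‖A‖

/-- Spectral condition number of a square matrix (meaningful when `A` is invertible). -/
def cond2 {n : ℕ} (A : Matrix (Fin n) (Fin n) ℂ) : ℝ := specNorm A * specNorm A⁻¹

/-- The solution `e = (Hᴴ H)⁻¹ x` of the normal equations. -/
def neSolution {M K : ℕ} (H : Matrix (Fin M) (Fin K) ℂ) (x : Fin K → ℂ) : Fin K → ℂ :=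
  (H.conjTranspose * H)⁻¹.mulVec x

/-- The exact zero-forcing transmit vector `s = √β H (Hᴴ H)⁻¹ x`. -/
def zfTransmit {M K : ℕ} (β : ℝ) (H : Matrix (Fin M) (Fin K) ℂ) (x : Fin K → ℂ) : Fin M → ℂ :=
  ((Real.sqrt β : ℝ) : ℂ) • H.mulVec (neSolution H x)

/-- The downlink channel: the users receive `√ρ Hᴴ s + n` when `s` is transmitted. -/
def received {M K : ℕ} (ρ : ℝ) (H : Matrix (Fin M) (Fin K) ℂ) (s : Fin M → ℂ)
    (noise : Fin K → ℂ) : Fin K → ℂ :=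
  ((Real.sqrt ρ : ℝ) : ℂ) • H.conjTranspose.mulVec s + noise

/-! ### The constants of the bound -/

/-- `γ_n = exp (λ √n u + n u² / (1 - u)) - 1`. -/
def gam (lam u : ℝ) (n : ℕ) : ℝ :=
  Real.exp (lam * Real.sqrt n * u + n * u ^ 2 / (1 - u)) - 1

/-- `c₁ = 2K (γ_{2M} + γ_{6K+1} / (1 - 2K γ_{2K+1}))`. -/
def c1 (M K : ℕ) (lam u : ℝ) : ℝ :=
  2 * K * (gam lam u (2 * M) + gam lam u (6 * K + 1) / (1 - 2 * K * gam lam u (2 * K + 1)))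

/-- `c = c₁ κ + √(2K) γ_{2K} (1 + c₁ κ)`, where `κ = κ₂ (Hᴴ H)`. -/
def cd {M K : ℕ} (H : Matrix (Fin M) (Fin K) ℂ) (lam u : ℝ) : ℝ :=
  c1 M K lam u * cond2 (H.conjTranspose * H)
    + Real.sqrt (2 * K) * gam lam u (2 * K)
      * (1 + c1 M K lam u * cond2 (H.conjTranspose * H))

/-! ### Elementary floating-point operations

Every real elementary operation of the algorithm has a label, and the relative error committed by
the operation with label `o` is `δ o`: the computed result is the exact result of the operation
on the already computed operands, times `1 + δ o`.  Copying, negation and complex conjugation are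
exact. -/

/-- The four steps of the algorithm (the third one consists of two triangular systems). -/
inductive Stage
  | gram | chol | forward | backward | product

/-- Real and imaginary part. -/
inductive Part
  | re | im

/-- Kind of an elementary operation (additions and subtractions share one kind). -/
inductive Kind
  | mul | add | quot | root

/-- Label of an elementary real operation: the stage, the entry of the result of that stage that
is being computed, its real or imaginary part, and the position among the operations of the same
kind that contribute to this part of this entry. -/
structure RoundOp where
  stage : Stage
  row : ℕ
  col : ℕ
  part : Part
  kind : Kind
  idx : ℕ

/-- The rounding errors are independent random variables of mean zero, bounded by the unit
roundoff `u`. -/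
structure RoundingModel {Ω : Type*} [MeasurableSpace Ω] (P : Measure Ω) (u : ℝ)
    (δ : RoundOp → Ω → ℝ) : Prop where
  measurable : ∀ o, Measurable (δ o)
  abs_le : ∀ o ω, |δ o ω| ≤ u
  mean_zero : ∀ o, ∫ ω, δ o ω ∂P = 0
  indep : iIndepFun δ P

/-- Rounded result of an operation with exact result `x` and relative error `d`. -/
def rnd (d x : ℝ) : ℝ := x * (1 + d)

/-- Recursive summation `w 0 + w 1 + ⋯ + w (n - 1)`, from left to right; `ε k` is the error of
the addition of `w k`. -/
def flSum (ε : ℕ → ℝ) : (n : ℕ) → (Fin n → ℝ) → ℝ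
  | 0, _ => 0
  | 1, w => w 0
  | n + 2, w =>
    rnd (ε (n + 1)) (flSum ε (n + 1) (fun k => w k.castSucc) + w (Fin.last (n + 1)))

/-- Successive subtraction `c - w 0 - w 1 - ⋯ - w (n - 1)`, from left to right; `ε k` is the error
of the subtraction of `w k`. -/
def flSubSum (ε : ℕ → ℝ) (c : ℝ) : (n : ℕ) → (Fin n → ℝ) → ℝ
  | 0, _ => c
  | n + 1, w => rnd (ε n) (flSubSum ε c n (fun k => w k.castSucc) - w (Fin.last n))

/-- Rounded products `a k * b k`. -/
def flTerms {n : ℕ} (μ : ℕ → ℝ) (a b : Fin n → ℝ) : Fin n → ℝ :=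
  fun k => rnd (μ k) (a k * b k)

/-- The real vector `[Re b; Im b]`. -/
def stack {n : ℕ} (b : Fin n → ℂ) : Fin (n + n) → ℝ :=
  Fin.append (fun k => (b k).re) (fun k => (b k).im)

/-- The real vector `[-Im a; Re a]`. -/
def stackRot {n : ℕ} (a : Fin n → ℂ) : Fin (n + n) → ℝ :=
  Fin.append (fun k => -(a k).im) (fun k => (a k).re)

/-- Rounded complex inner product `aᴴ b`, evaluated as the two real inner products
`[Re a; Im a]ᵀ [Re b; Im b]` and `[-Im a; Re a]ᵀ [Re b; Im b]`. -/
def flInner {n : ℕ} (E : Part → Kind → ℕ → ℝ) (a b : Fin n → ℂ) : ℂ where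
  re := flSum (E .re .add) (n + n) (flTerms (E .re .mul) (stack a) (stack b))
  im := flSum (E .im .add) (n + n) (flTerms (E .im .mul) (stackRot a) (stack b))

/-- Rounded value of `c - aᴴ b`, evaluated in the same way with successive subtractions. -/
def flSubInner {n : ℕ} (E : Part → Kind → ℕ → ℝ) (c : ℂ) (a b : Fin n → ℂ) : ℂ where
  re := flSubSum (E .re .add) c.re (n + n) (flTerms (E .re .mul) (stack a) (stack b))
  im := flSubSum (E .im .add) c.im (n + n) (flTerms (E .im .mul) (stackRot a) (stack b))

/-- Rounded quotient of a complex number by a real number. -/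
def flDivReal (E : Part → Kind → ℕ → ℝ) (c : ℂ) (d : ℝ) : ℂ where
  re := rnd (E .re .quot 0) (c.re / d)
  im := rnd (E .im .quot 0) (c.im / d)

/-- The rounding errors committed in the computation of the entry `(i, j)` at stage `t`. -/
def errAt (δ : RoundOp → ℝ) (t : Stage) (i j : ℕ) : Part → Kind → ℕ → ℝ :=
  fun p o k => δ ⟨t, i, j, p, o, k⟩

/-! ### The algorithm -/

/-- Rounded matrix-matrix product `A B`. -/
def flMatMul {m n p : ℕ} (δ : RoundOp → ℝ) (t : Stage) (A : Matrix (Fin m) (Fin n) ℂ)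
    (B : Matrix (Fin n) (Fin p) ℂ) : Matrix (Fin m) (Fin p) ℂ :=
  fun i j => flInner (errAt δ t i j) (fun k => star (A i k)) (fun k => B k j)

/-- Rounded matrix-vector product `A v`. -/
def flMulVec {m n : ℕ} (δ : RoundOp → ℝ) (t : Stage) (A : Matrix (Fin m) (Fin n) ℂ)
    (v : Fin n → ℂ) : Fin m → ℂ :=
  fun i => flInner (errAt δ t i 0) (fun k => star (A i k)) v

/-- Cholesky factorization `C = Rᴴ R` with `R` upper triangular, in rounded arithmetic.  Row `i` is
obtained from the rows above it:
`r i i = √(c i i - ∑ k < i, |r k i|²)` and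
`r i j = (c i j - ∑ k < i, conj (r k i) * r k j) / r i i` for `i < j`.
As usual for a Hermitian argument, only the real parts of the diagonal entries and the
entries above the diagonal are read. -/
def flChol {K : ℕ} (δ : RoundOp → ℝ) (C : Matrix (Fin K) (Fin K) ℂ) (i : Fin K) : Fin K → ℂ :=
  fun j =>
    let above : Fin K → Fin i.val → ℂ := fun l k => flChol δ C ⟨k.val, k.isLt.trans i.isLt⟩ l
    let num : Fin K → ℂ := fun l =>
      flSubInner (errAt δ .chol i l) (C i l) (above i) (above l)
    let d : ℝ := rnd (errAt δ .chol i i .re .root 0) (Real.sqrt (num i).re)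
    if j < i then 0 else if j = i then (d : ℂ) else flDivReal (errAt δ .chol i j) (num j) d
termination_by i.val
decreasing_by exact k.isLt

/-- Forward substitution for `Rᴴ q = x` in rounded arithmetic:
`q i = (x i - ∑ k < i, conj (r k i) * q k) / r i i`. -/
def flForward {K : ℕ} (δ : RoundOp → ℝ) (R : Matrix (Fin K) (Fin K) ℂ) (x : Fin K → ℂ)
    (i : Fin K) : ℂ :=
  flDivReal (errAt δ .forward i 0)
    (flSubInner (errAt δ .forward i 0) (x i)
      (fun k : Fin i.val => R ⟨k.val, k.isLt.trans i.isLt⟩ i)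
      (fun k : Fin i.val => flForward δ R x ⟨k.val, k.isLt.trans i.isLt⟩))
    (R i i).re
termination_by i.val
decreasing_by exact k.isLt

/-- Back substitution for `R e = q` in rounded arithmetic:
`e i = (q i - ∑ k > i, r i k * e k) / r i i`. -/
def flBackward {K : ℕ} (δ : RoundOp → ℝ) (R : Matrix (Fin K) (Fin K) ℂ) (q : Fin K → ℂ)
    (i : Fin K) : ℂ :=
  flDivReal (errAt δ .backward i 0)
    (flSubInner (errAt δ .backward i 0) (q i)
      (fun k : Fin (K - (i.val + 1)) => star (R i ⟨i.val + 1 + k.val, by omega⟩))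
      (fun k : Fin (K - (i.val + 1)) => flBackward δ R q ⟨i.val + 1 + k.val, by omega⟩))
    (R i i).re
termination_by K - i.val
decreasing_by omega

/-- The computed solution of the normal equations `Hᴴ H e = x`: rounded Gram matrix, rounded
Cholesky factorization, and two rounded triangular solves. -/
def flNESolution {M K : ℕ} (δ : RoundOp → ℝ) (H : Matrix (Fin M) (Fin K) ℂ) (x : Fin K → ℂ) :
    Fin K → ℂ :=
  let C := flMatMul δ .gram H.conjTranspose H
  let R : Matrix (Fin K) (Fin K) ℂ := flChol δ C
  let q := flForward δ R x
  flBackward δ R q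

/-- Zero-forcing precoding by the normal equations method in rounded arithmetic: the output is the
rounded product of `H` with the computed solution of the normal equations, scaled by the power
normalization `√β`. -/
def flTransmit {M K : ℕ} (δ : RoundOp → ℝ) (β : ℝ) (H : Matrix (Fin M) (Fin K) ℂ)
    (x : Fin K → ℂ) : Fin M → ℂ :=
  ((Real.sqrt β : ℝ) : ℂ) • flMulVec δ .product H (flNESolution δ H x)

end ZFPrecoding

end

/-! Randomness enters through a single event; the rest is deterministic backward error analysis.
Written as residuals, every rounded inner product, quotient and pivot satisfies its exact equation
up to relative perturbations of its terms. These perturbations involve only single factors `1 + δ`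
and prefix products of the addition factors of one entry. For a fixed entry the addition errors are
independent, centred and bounded by `u`, so Hoeffding's inequality keeps each prefix sum below `l √N
u` outside probability `2 exp (-l²/2)`, with `N = 2M` for the Gram matrix and `N = 2K` elsewhere.
Only the errors themselves are controlled, never the operands, so the dependence of later operands
on earlier errors does no harm. A union bound gives `RoundingModel.measureReal_badEvent_le`.

Let `s` and `t` be the two tolerances `l √N u`, put `g = 20 (s + t)`, `A = Hᴴ H`, and let `w j` be
the column norms of `H`. On the good event the computed Gram matrix is within `g * w i * w j` of `A`
entrywise. If the Cholesky factorization broke down at some first pivot, a vector annihilated by the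
rows already found would make the quadratic form of `A` of size `O(g)`, against its coercivity
(`exists_small_quadForm`, `forall_pivotResidual`). Hence all pivots are positive, and
`vecNorm_mulVec_sub_le` bounds the residual of the computed solution by `8 g T² ‖e‖`, where `T = √K
‖H‖`. Applying `A⁻¹` produces the condition number, and the hypothesis on `τ` turns an error
relative to `‖H‖ ‖e‖` into one relative to `‖H e‖`.

With `l = λ / (1000 τ)` the tolerances are smaller than the corresponding `γ` by a factor `1000 τ`.
This slack absorbs `τ` and all numerical constants into `cd`; its price is the `τ²` in the exponent.
For `l < 1` the probability bound is vacuous. -/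

noncomputable section

namespace ZFPrecoding

/-! ### Products of rounding factors -/

/-- `∏ j < k, (1 + ε j)`. -/
def prefixProd (ε : ℕ → ℝ) (k : ℕ) : ℝ := ∏ j ∈ Finset.range k, (1 + ε j)

lemma prefixProd_succ (ε : ℕ → ℝ) (k : ℕ) :
    prefixProd ε (k + 1) = prefixProd ε k * (1 + ε k) :=
  Finset.prod_range_succ _ _

/-- Follows from `exp y ≤ 1 + y + y²` at `y = x - 2x²`. It lets a product of factors `1 + ε` be
bounded below by the exponential of the sum of the errors, with a second-order loss. -/
lemma exp_sub_two_sq_le {x : ℝ} (hx : |x| ≤ 1 / 10) : Real.exp (x - 2 * x ^ 2) ≤ 1 + x := by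
  obtain ⟨h1, h2⟩ := abs_le.1 hx
  have hy : |x - 2 * x ^ 2| ≤ 1 := by
    rw [abs_le]; constructor <;> nlinarith
  have h := (abs_le.1 (Real.abs_exp_sub_one_sub_id_le hy)).2
  have : 0 ≤ x ^ 2 * (1 + 4 * x - 4 * x ^ 2) := by
    apply mul_nonneg (sq_nonneg x); nlinarith
  nlinarith

/-- The product is at most `exp t ≤ 1 + 2t`, and at least `exp (-t - 2 N u²) ≥ exp (-3t)`.
Cancellation among the errors is used only through `hsum`. -/
lemma abs_prefixProd_sub_one_le {ε : ℕ → ℝ} {k N : ℕ} {u t : ℝ} (hε : ∀ j, |ε j| ≤ u)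
    (hkN : k ≤ N) (hsum : |∑ j ∈ Finset.range k, ε j| ≤ t) (hN : N * u ^ 2 ≤ t)
    (hu : u ≤ 1 / 10) (ht : t ≤ 1 / 10) : |prefixProd ε k - 1| ≤ 3 * t := by
  have hu0 : 0 ≤ u := (abs_nonneg _).trans (hε 0)
  have ht0 : 0 ≤ t := (abs_nonneg _).trans hsum
  obtain ⟨hs1, hs2⟩ := abs_le.1 hsum
  have hpos : ∀ j, 0 ≤ 1 + ε j := fun j => by
    have := (abs_le.1 (hε j)).1; linarith
  have hup : prefixProd ε k ≤ Real.exp t := by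
    calc prefixProd ε k ≤ ∏ j ∈ Finset.range k, Real.exp (ε j) :=
          Finset.prod_le_prod (fun j _ => hpos j) fun j _ => by
            rw [add_comm]; exact Real.add_one_le_exp _
      _ = Real.exp (∑ j ∈ Finset.range k, ε j) := (Real.exp_sum _ _).symm
      _ ≤ Real.exp t := Real.exp_le_exp.2 hs2
  have hlow : Real.exp (-(3 * t)) ≤ prefixProd ε k := by
    calc Real.exp (-(3 * t)) ≤ Real.exp (∑ j ∈ Finset.range k, (ε j - 2 * ε j ^ 2)) := by
          apply Real.exp_le_exp.2
          rw [Finset.sum_sub_distrib]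
          have h1 : ∑ j ∈ Finset.range k, 2 * ε j ^ 2 ≤ ∑ _j ∈ Finset.range k, 2 * u ^ 2 :=
            Finset.sum_le_sum fun j _ => by
              have := sq_le_sq' (abs_le.1 (hε j)).1 (abs_le.1 (hε j)).2
              linarith
          rw [Finset.sum_const, Finset.card_range, nsmul_eq_mul] at h1
          have h2 : (k : ℝ) * u ^ 2 ≤ N * u ^ 2 :=
            mul_le_mul_of_nonneg_right (by exact_mod_cast hkN) (sq_nonneg u)
          linarith
      _ = ∏ j ∈ Finset.range k, Real.exp (ε j - 2 * ε j ^ 2) := Real.exp_sum _ _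
      _ ≤ prefixProd ε k := Finset.prod_le_prod (fun j _ => (Real.exp_pos _).le)
          fun j _ => exp_sub_two_sq_le ((hε j).trans hu)
  have h1 := Real.add_one_le_exp (-(3 * t))
  have h2 := (abs_le.1 (Real.abs_exp_sub_one_le (x := t) (by rw [abs_of_nonneg ht0]; linarith))).2
  rw [abs_of_nonneg ht0] at h2
  rw [abs_le]; constructor <;> linarith

/-- The summand `w k` passes through the additions `max k 1, …, n`: the first summand is copied
exactly, so `ε 0` never occurs. Writing the interval product as a quotient of prefix products means
that only prefixes have to be controlled. -/
lemma flSum_succ_eq (ε : ℕ → ℝ) (n : ℕ) (hP : ∀ k ≤ n + 1, prefixProd ε k ≠ 0)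
    (w : Fin (n + 1) → ℝ) :
    flSum ε (n + 1) w
      = ∑ k, w k * (prefixProd ε (n + 1) / prefixProd ε (max k.val 1)) := by
  induction n with
  | zero => simp [flSum, hP 1 le_rfl]
  | succ n ih =>
    have hmax : max (n + 1) 1 = n + 1 := by omega
    rw [flSum, rnd, ih (fun k hk => hP k (by omega)), Fin.sum_univ_castSucc (n := n + 1)]
    simp only [Fin.val_castSucc, Fin.val_last, hmax]
    rw [prefixProd_succ ε (n + 1), add_mul, Finset.sum_mul]
    congr 1
    · exact Finset.sum_congr rfl fun k _ => by ring
    · rw [mul_div_cancel_left₀ _ (hP (n + 1) (by omega))]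

/-- Pulling out the full product leaves `c` unperturbed: the errors fall on the subtracted terms and
on the computed value, as a residual bound requires. -/
lemma flSubSum_eq (ε : ℕ → ℝ) (c : ℝ) (n : ℕ) (hP : ∀ k ≤ n, prefixProd ε k ≠ 0)
    (w : Fin n → ℝ) :
    flSubSum ε c n w = prefixProd ε n * (c - ∑ k, w k / prefixProd ε k.val) := by
  induction n with
  | zero => simp [flSubSum, prefixProd]
  | succ n ih =>
    have h := hP n (by omega)
    rw [flSubSum, rnd, ih (fun k hk => hP k (by omega)), Fin.sum_univ_castSucc,
      prefixProd_succ]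
    simp only [Fin.val_castSucc, Fin.val_last]
    field_simp
    ring

/-- The errors of the computation of one entry: each is at most `t`, and the products of up to `N`
addition factors are within `3 t` of `1`. -/
structure SmallErrors (E : Part → Kind → ℕ → ℝ) (N : ℕ) (t : ℝ) : Prop where
  small : t ≤ 1 / 100
  error_le : ∀ p o k, |E p o k| ≤ t
  prefix_le : ∀ p, ∀ k ≤ N, |prefixProd (E p .add) k - 1| ≤ 3 * t

lemma SmallErrors.nonneg {E : Part → Kind → ℕ → ℝ} {N : ℕ} {t : ℝ} (h : SmallErrors E N t) :
    0 ≤ t := (abs_nonneg _).trans (h.error_le .re .add 0)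

lemma SmallErrors.prefix_pos {E : Part → Kind → ℕ → ℝ} {N : ℕ} {t : ℝ} (h : SmallErrors E N t)
    (p : Part) {k : ℕ} (hk : k ≤ N) : 0 < prefixProd (E p .add) k := by
  have := (abs_le.1 (h.prefix_le p k hk)).1
  have := h.small
  linarith

lemma abs_mul_div_sub_one_le {a b c t : ℝ} (ht : t ≤ 1 / 100) (ha : |a| ≤ t)
    (hb : |b - 1| ≤ 3 * t) (hc : |c - 1| ≤ 3 * t) : |(1 + a) * (b / c) - 1| ≤ 10 * t := by
  obtain ⟨a1, a2⟩ := abs_le.1 ha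
  obtain ⟨b1, b2⟩ := abs_le.1 hb
  obtain ⟨c1, c2⟩ := abs_le.1 hc
  have ht0 : 0 ≤ t := (abs_nonneg _).trans ha
  have hcpos : 0 < c := by linarith
  rw [← mul_div_assoc, abs_le, le_sub_iff_add_le, sub_le_iff_le_add, le_div_iff₀ hcpos,
    div_le_iff₀ hcpos]
  constructor <;> nlinarith

lemma abs_sum_mul_sub_sum_le {n : ℕ} {a θ : Fin n → ℝ} {g : ℝ} (hθ : ∀ k, |θ k - 1| ≤ g) :
    |∑ k, a k * θ k - ∑ k, a k| ≤ g * ∑ k, |a k| := by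
  rw [← Finset.sum_sub_distrib, Finset.mul_sum]
  refine (Finset.abs_sum_le_sum_abs _ _).trans (Finset.sum_le_sum fun k _ => ?_)
  rw [show a k * θ k - a k = (θ k - 1) * a k by ring, abs_mul]
  exact mul_le_mul_of_nonneg_right (hθ k) (abs_nonneg _)

lemma abs_flSum_flTerms_sub_le {E : Part → Kind → ℕ → ℝ} {N : ℕ} {t : ℝ} (h : SmallErrors E N t)
    (p : Part) {n : ℕ} (hn : n ≤ N) (a b : Fin n → ℝ) :
    |flSum (E p .add) n (flTerms (E p .mul) a b) - ∑ k, a k * b k|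
      ≤ 10 * t * ∑ k, |a k * b k| := by
  cases n with
  | zero => simp [flSum]
  | succ n =>
    rw [flSum_succ_eq _ _ (fun k hk => (h.prefix_pos p (hk.trans hn)).ne')]
    have : ∀ k : Fin (n + 1), flTerms (E p .mul) a b k *
        (prefixProd (E p .add) (n + 1) / prefixProd (E p .add) (max k.val 1))
        = (a k * b k) * ((1 + E p .mul k) *
        (prefixProd (E p .add) (n + 1) / prefixProd (E p .add) (max k.val 1))) := fun k => by
      rw [flTerms, rnd]; ring
    simp only [this]
    refine abs_sum_mul_sub_sum_le fun k => abs_mul_div_sub_one_le h.small (h.error_le _ _ _)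
      (h.prefix_le p _ hn) (h.prefix_le p _ ?_)
    have := k.isLt; omega

lemma flSubSum_flTerms {E : Part → Kind → ℕ → ℝ} {N : ℕ} {t : ℝ} (h : SmallErrors E N t)
    (p : Part) {n : ℕ} (hn : n ≤ N) (c : ℝ) (a b : Fin n → ℝ) :
    ∃ s, flSubSum (E p .add) c n (flTerms (E p .mul) a b) = prefixProd (E p .add) n * (c - s) ∧
      |s - ∑ k, a k * b k| ≤ 10 * t * ∑ k, |a k * b k| := by
  refine ⟨_, flSubSum_eq _ _ _ (fun k hk => (h.prefix_pos p (hk.trans hn)).ne') _, ?_⟩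
  have : ∀ k : Fin n, flTerms (E p .mul) a b k / prefixProd (E p .add) k.val
      = (a k * b k) * ((1 + E p .mul k) * (1 / prefixProd (E p .add) k.val)) := fun k => by
    rw [flTerms, rnd]; ring
  simp only [this]
  have ht := h.nonneg
  exact abs_sum_mul_sub_sum_le fun k => abs_mul_div_sub_one_le h.small (h.error_le _ _ _)
    (by simpa using ht) (h.prefix_le p _ (k.isLt.le.trans hn))

/-! ### Complex inner products through real and imaginary parts -/

lemma sum_stack_mul {n : ℕ} (a b : Fin n → ℂ) :
    ∑ k, stack a k * stack b k = (∑ k, star (a k) * b k).re := by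
  simp only [stack, Fin.sum_univ_add, Fin.append_left, Fin.append_right, Complex.re_sum]
  rw [← Finset.sum_add_distrib]
  exact Finset.sum_congr rfl fun k _ => by simp

lemma sum_stackRot_mul {n : ℕ} (a b : Fin n → ℂ) :
    ∑ k, stackRot a k * stack b k = (∑ k, star (a k) * b k).im := by
  simp only [stack, stackRot, Fin.sum_univ_add, Fin.append_left, Fin.append_right,
    Complex.im_sum]
  rw [← Finset.sum_add_distrib]
  exact Finset.sum_congr rfl fun k _ => by simp; ring

/-- Cauchy–Schwarz in the plane, applied to the absolute values of the real and imaginary parts. -/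
lemma abs_mul_add_abs_mul_le_norm_mul (z w : ℂ) :
    |z.re * w.re| + |z.im * w.im| ≤ ‖z‖ * ‖w‖ := by
  have hz := Complex.sq_norm z
  have hw := Complex.sq_norm w
  rw [Complex.normSq_apply] at hz hw
  rw [abs_mul, abs_mul]
  refine abs_le_of_sq_le_sq' ?_ (by positivity) |>.2
  have h1 : (‖z‖ * ‖w‖) ^ 2 = (|z.re| ^ 2 + |z.im| ^ 2) * (|w.re| ^ 2 + |w.im| ^ 2) := by
    rw [mul_pow, hz, hw]; simp only [sq_abs]; ring
  rw [h1]
  nlinarith [sq_nonneg (|z.re| * |w.im| - |z.im| * |w.re|)]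

lemma sum_abs_stack_mul_le {n : ℕ} (a b : Fin n → ℂ) :
    ∑ k, |stack a k * stack b k| ≤ ∑ k, ‖a k‖ * ‖b k‖ := by
  simp only [stack, Fin.sum_univ_add, Fin.append_left, Fin.append_right]
  rw [← Finset.sum_add_distrib]
  exact Finset.sum_le_sum fun k _ => abs_mul_add_abs_mul_le_norm_mul _ _

lemma sum_abs_stackRot_mul_le {n : ℕ} (a b : Fin n → ℂ) :
    ∑ k, |stackRot a k * stack b k| ≤ ∑ k, ‖a k‖ * ‖b k‖ := by
  simp only [stack, stackRot, Fin.sum_univ_add, Fin.append_left, Fin.append_right]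
  rw [← Finset.sum_add_distrib]
  refine Finset.sum_le_sum fun k _ => ?_
  -- Multiplication by `I` turns the pair `(Re a, Im a)` into `(-Im a, Re a)`.
  have h := abs_mul_add_abs_mul_le_norm_mul (Complex.I * a k) (b k)
  simpa using h

lemma norm_flInner_sub_le {E : Part → Kind → ℕ → ℝ} {N : ℕ} {t : ℝ} (h : SmallErrors E N t)
    {n : ℕ} (hn : n + n ≤ N) (a b : Fin n → ℂ) :
    ‖flInner E a b - ∑ k, star (a k) * b k‖ ≤ 20 * t * ∑ k, ‖a k‖ * ‖b k‖ := by
  have ht := h.nonneg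
  refine (Complex.norm_le_abs_re_add_abs_im _).trans ?_
  rw [Complex.sub_re, Complex.sub_im, ← sum_stack_mul, ← sum_stackRot_mul]
  have h1 := abs_flSum_flTerms_sub_le h .re hn (stack a) (stack b)
  have h2 := abs_flSum_flTerms_sub_le h .im hn (stackRot a) (stack b)
  have h3 := mul_le_mul_of_nonneg_left (sum_abs_stack_mul_le a b) (by linarith : 0 ≤ 10 * t)
  have h4 := mul_le_mul_of_nonneg_left (sum_abs_stackRot_mul_le a b) (by linarith : 0 ≤ 10 * t)
  simp only [flInner]
  linarith

/-! ### Residuals of rounded quotients and square roots. -/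

lemma abs_one_div_sub_one_le {y t : ℝ} (ht0 : 0 ≤ t) (ht : t ≤ 1 / 100) (h1 : 1 - 5 * t ≤ y)
    (h2 : y ≤ 1 + 6 * t) : |1 / y - 1| ≤ 10 * t := by
  have hpos : 0 < y := by linarith
  rw [abs_le, le_sub_iff_add_le, sub_le_iff_le_add, le_div_iff₀ hpos, div_le_iff₀ hpos]
  constructor <;> nlinarith

lemma abs_inv_mul_sub_one_le {a b t : ℝ} (ht : t ≤ 1 / 100) (ha : |a| ≤ t)
    (hb : |b - 1| ≤ 3 * t) : |1 / ((1 + a) * b) - 1| ≤ 10 * t := by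
  obtain ⟨a1, a2⟩ := abs_le.1 ha
  obtain ⟨b1, b2⟩ := abs_le.1 hb
  have ht0 : 0 ≤ t := (abs_nonneg _).trans ha
  apply abs_one_div_sub_one_le ht0 ht <;> nlinarith

lemma abs_inv_sq_mul_sub_one_le {a b t : ℝ} (ht : t ≤ 1 / 100) (ha : |a| ≤ t)
    (hb : |b - 1| ≤ 3 * t) : |1 / ((1 + a) ^ 2 * b) - 1| ≤ 10 * t := by
  obtain ⟨a1, a2⟩ := abs_le.1 ha
  obtain ⟨b1, b2⟩ := abs_le.1 hb
  have ht0 : 0 ≤ t := (abs_nonneg _).trans ha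
  have h1 : (1 + a) ^ 2 ≤ 1 + 2 * t + t ^ 2 := by nlinarith
  have h2 : 1 - 2 * t ≤ (1 + a) ^ 2 := by nlinarith
  have h3 : (1 + a) ^ 2 * b ≤ (1 + 2 * t + t ^ 2) * (1 + 3 * t) :=
    mul_le_mul h1 (by linarith) (by linarith) (by positivity)
  have h4 : (1 - 2 * t) * (1 - 3 * t) ≤ (1 + a) ^ 2 * b :=
    mul_le_mul h2 (by linarith) (by linarith) (by positivity)
  apply abs_one_div_sub_one_le ht0 ht <;> nlinarith

/-- With `y` the computed quotient times `d`, one has `y = (1 + δ) p (c - s)`, so `c = s + y / ((1 +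
δ) p)` exactly. The error is thus relative to `y` and to the subtracted sum, never to `c`. -/
lemma abs_quot_residual_le {c s d p δ t S A : ℝ} (hd : d ≠ 0) (ht : t ≤ 1 / 100)
    (hδ : |δ| ≤ t) (hp : |p - 1| ≤ 3 * t) (hs : |s - S| ≤ 10 * t * A) :
    |d * rnd δ (p * (c - s) / d) + S - c| ≤ 10 * t * (|d * rnd δ (p * (c - s) / d)| + A) := by
  obtain ⟨a1, a2⟩ := abs_le.1 hδ
  obtain ⟨b1, b2⟩ := abs_le.1 hp
  have hx : d * rnd δ (p * (c - s) / d) = ((1 + δ) * p) * (c - s) := by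
    rw [rnd]; field_simp
  rw [hx]
  have hδ0 : 1 + δ ≠ 0 := (by linarith : (0 : ℝ) < 1 + δ).ne'
  have hp0 : p ≠ 0 := (by linarith : (0 : ℝ) < p).ne'
  set y := (1 + δ) * p * (c - s) with hy
  have hcs : c - s = y * (1 / ((1 + δ) * p)) := by rw [hy]; field_simp
  have h1 : y + S - c = -(y * (1 / ((1 + δ) * p) - 1)) - (s - S) := by
    rw [mul_sub, ← hcs]; ring
  rw [h1]
  refine (abs_sub _ _).trans ?_
  rw [abs_neg, abs_mul]
  have := mul_le_mul_of_nonneg_left (abs_inv_mul_sub_one_le ht hδ hp) (abs_nonneg y)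
  linarith

/-- Residual of a complex number computed by an inner product, a subtraction and a division. -/
lemma norm_flDivReal_flSubInner_residual_le {E : Part → Kind → ℕ → ℝ} {N : ℕ} {t : ℝ}
    (h : SmallErrors E N t) {n : ℕ} (hn : n + n ≤ N) (c : ℂ) (a b : Fin n → ℂ) {d : ℝ}
    (hd : d ≠ 0) :
    ‖d * flDivReal E (flSubInner E c a b) d + ∑ k, star (a k) * b k - c‖
      ≤ 20 * t * (‖(d : ℂ)‖ * ‖flDivReal E (flSubInner E c a b) d‖ + ∑ k, ‖a k‖ * ‖b k‖) := by
  have ht := h.nonneg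
  obtain ⟨s1, e1, b1⟩ := flSubSum_flTerms h .re hn c.re (stack a) (stack b)
  obtain ⟨s2, e2, b2⟩ := flSubSum_flTerms h .im hn c.im (stackRot a) (stack b)
  have r1 := abs_quot_residual_le (c := c.re) hd h.small (h.error_le .re .quot 0)
    (h.prefix_le .re _ hn) b1
  have r2 := abs_quot_residual_le (c := c.im) hd h.small (h.error_le .im .quot 0)
    (h.prefix_le .im _ hn) b2
  rw [← e1, sum_stack_mul] at r1
  rw [← e2, sum_stackRot_mul] at r2
  have h3 := sum_abs_stack_mul_le a b
  have h4 := sum_abs_stackRot_mul_le a b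
  set q := flDivReal E (flSubInner E c a b) d with hq
  change |d * q.re + _ - _| ≤ 10 * t * (|d * q.re| + _) at r1
  change |d * q.im + _ - _| ≤ 10 * t * (|d * q.im| + _) at r2
  have h5 : |d * q.re| ≤ ‖(d : ℂ)‖ * ‖q‖ := by
    rw [abs_mul, Complex.norm_real]
    exact mul_le_mul_of_nonneg_left (Complex.abs_re_le_norm q) (abs_nonneg d)
  have h6 : |d * q.im| ≤ ‖(d : ℂ)‖ * ‖q‖ := by
    rw [abs_mul, Complex.norm_real]
    exact mul_le_mul_of_nonneg_left (Complex.abs_im_le_norm q) (abs_nonneg d)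
  have h7 := mul_le_mul_of_nonneg_left (add_le_add h5 h3) (by linarith : 0 ≤ 10 * t)
  have h8 := mul_le_mul_of_nonneg_left (add_le_add h6 h4) (by linarith : 0 ≤ 10 * t)
  refine (Complex.norm_le_abs_re_add_abs_im _).trans ?_
  simp only [Complex.sub_re, Complex.sub_im, Complex.add_re, Complex.add_im,
    Complex.re_ofReal_mul, Complex.im_ofReal_mul]
  linarith

/-- A pivot of the rounded Cholesky factorization: it is positive with a small residual unless the
exact pivot is tiny or negative. -/
lemma flSubInner_sqrt_pivot {E : Part → Kind → ℕ → ℝ} {N : ℕ} {t : ℝ}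
    (h : SmallErrors E N t) {n : ℕ} (hn : n + n ≤ N) (c : ℂ) (a : Fin n → ℂ) :
    c.re - ∑ k, ‖a k‖ ^ 2 ≤ 10 * t * ∑ k, ‖a k‖ ^ 2 ∨
      0 < rnd (E .re .root 0) (Real.sqrt (flSubInner E c a a).re) ∧
      |rnd (E .re .root 0) (Real.sqrt (flSubInner E c a a).re) ^ 2 + ∑ k, ‖a k‖ ^ 2 - c.re|
        ≤ 10 * t * (rnd (E .re .root 0) (Real.sqrt (flSubInner E c a a).re) ^ 2
          + ∑ k, ‖a k‖ ^ 2) := by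
  have ht := h.nonneg
  have ht1 := h.small
  obtain ⟨s, e, b⟩ := flSubSum_flTerms h .re hn c.re (stack a) (stack a)
  have hS : ∑ k, stack a k * stack a k = ∑ k, ‖a k‖ ^ 2 := by
    rw [sum_stack_mul, Complex.re_sum]
    refine Finset.sum_congr rfl fun k _ => ?_
    rw [Complex.sq_norm, Complex.normSq_apply]
    simp
  have hA : ∑ k, |stack a k * stack a k| = ∑ k, ‖a k‖ ^ 2 := by
    rw [← hS]
    exact Finset.sum_congr rfl fun k _ => abs_of_nonneg (mul_self_nonneg _)
  rw [hA, hS] at b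
  have e' : (flSubInner E c a a).re = prefixProd (E .re .add) (n + n) * (c.re - s) := e
  rw [e']
  set S := ∑ k, ‖a k‖ ^ 2
  set δ := E .re .root 0
  set p := prefixProd (E .re .add) (n + n)
  have hp := h.prefix_le .re _ hn
  have hp0 : 0 < p := h.prefix_pos .re hn
  have hδ : |δ| ≤ t := h.error_le .re .root 0
  obtain ⟨δ1, δ2⟩ := abs_le.1 hδ
  -- As `p > 0`, the argument of the square root has the sign of `c.re - s`. If it is not positive,
  -- the exact pivot is at most the rounding error of the sum.
  by_cases hcs : c.re - s ≤ 0
  · left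
    have := (abs_le.1 b).2
    linarith
  · right
    push Not at hcs
    have hpos : 0 < p * (c.re - s) := mul_pos hp0 hcs
    have h1δ : 0 < 1 + δ := by linarith
    refine ⟨mul_pos (Real.sqrt_pos.2 hpos) h1δ, ?_⟩
    rw [rnd, mul_pow, Real.sq_sqrt hpos.le]
    set y := p * (c.re - s) * (1 + δ) ^ 2 with hy
    have hy0 : 0 < y := by positivity
    have hcs' : c.re - s = y * (1 / ((1 + δ) ^ 2 * p)) := by rw [hy]; field_simp
    have h1 : y + S - c.re = -(y * (1 / ((1 + δ) ^ 2 * p) - 1)) - (s - S) := by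
      rw [mul_sub, ← hcs']; ring
    rw [h1]
    refine (abs_sub _ _).trans ?_
    rw [abs_neg, abs_mul, abs_of_pos hy0]
    have := mul_le_mul_of_nonneg_left (abs_inv_sq_mul_sub_one_le ht1 hδ hp) hy0.le
    linarith

/-! ### Euclidean norm of complex vectors -/

lemma vecNorm_nonneg {n : ℕ} (v : Fin n → ℂ) : 0 ≤ vecNorm v := norm_nonneg _

lemma vecNorm_sq {n : ℕ} (v : Fin n → ℂ) : vecNorm v ^ 2 = ∑ i, ‖v i‖ ^ 2 := by
  rw [vecNorm, EuclideanSpace.norm_sq_eq]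

lemma vecNorm_add_le {n : ℕ} (v w : Fin n → ℂ) : vecNorm (v + w) ≤ vecNorm v + vecNorm w := by
  simp only [vecNorm, WithLp.toLp_add]
  exact norm_add_le _ _

lemma vecNorm_sub_le {n : ℕ} (v w : Fin n → ℂ) : vecNorm (v - w) ≤ vecNorm v + vecNorm w := by
  simp only [vecNorm, WithLp.toLp_sub]
  exact norm_sub_le _ _

lemma vecNorm_smul {n : ℕ} (c : ℂ) (v : Fin n → ℂ) : vecNorm (c • v) = ‖c‖ * vecNorm v := by
  simp only [vecNorm, WithLp.toLp_smul]
  exact norm_smul _ _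

lemma norm_apply_le_vecNorm {n : ℕ} (v : Fin n → ℂ) (i : Fin n) : ‖v i‖ ≤ vecNorm v := by
  refine abs_le_of_sq_le_sq' ?_ (vecNorm_nonneg v) |>.2
  rw [vecNorm_sq]
  exact Finset.single_le_sum (f := fun i => ‖v i‖ ^ 2) (fun j _ => sq_nonneg _)
    (Finset.mem_univ i)

lemma sum_mul_le_of_sq_le {n : ℕ} {a b : Fin n → ℝ} {s t : ℝ} (hs : 0 ≤ s) (ht : 0 ≤ t)
    (ha : ∑ i, a i ^ 2 ≤ s ^ 2) (hb : ∑ i, b i ^ 2 ≤ t ^ 2) : ∑ i, a i * b i ≤ s * t := by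
  refine abs_le_of_sq_le_sq' ?_ (mul_nonneg hs ht) |>.2
  rw [mul_pow]
  exact (Finset.sum_mul_sq_le_sq_mul_sq _ _ _).trans
    (mul_le_mul ha hb (Finset.sum_nonneg fun _ _ => sq_nonneg _) (sq_nonneg _))

lemma sum_norm_mul_norm_le {n : ℕ} (v w : Fin n → ℂ) :
    ∑ i, ‖v i‖ * ‖w i‖ ≤ vecNorm v * vecNorm w :=
  sum_mul_le_of_sq_le (vecNorm_nonneg v) (vecNorm_nonneg w) (vecNorm_sq v).ge (vecNorm_sq w).ge

lemma norm_sum_mul_le {n : ℕ} (v w : Fin n → ℂ) :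
    ‖∑ i, v i * w i‖ ≤ vecNorm v * vecNorm w := by
  refine (norm_sum_le _ _).trans ?_
  simp only [norm_mul]
  exact sum_norm_mul_norm_le v w

lemma vecNorm_star {n : ℕ} (v : Fin n → ℂ) : vecNorm (fun i => star (v i)) = vecNorm v := by
  rw [← sq_eq_sq₀ (vecNorm_nonneg _) (vecNorm_nonneg _), vecNorm_sq, vecNorm_sq]
  simp

lemma norm_sum_star_mul_le {n : ℕ} (v w : Fin n → ℂ) :
    ‖∑ i, star (v i) * w i‖ ≤ vecNorm v * vecNorm w := by
  have := norm_sum_mul_le (fun i => star (v i)) w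
  rwa [vecNorm_star] at this

lemma vecNorm_le_of_forall {n : ℕ} {v : Fin n → ℂ} {c : Fin n → ℝ} {r s : ℝ}
    (hr : 0 ≤ r) (hs : 0 ≤ s) (hc : ∑ i, c i ^ 2 ≤ r ^ 2) (h : ∀ i, ‖v i‖ ≤ c i * s) :
    vecNorm v ≤ r * s := by
  refine abs_le_of_sq_le_sq' ?_ (mul_nonneg hr hs) |>.2
  rw [vecNorm_sq, mul_pow]
  calc ∑ i, ‖v i‖ ^ 2 ≤ ∑ i, c i ^ 2 * s ^ 2 := Finset.sum_le_sum fun i _ => by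
        rw [← mul_pow]; exact pow_le_pow_left₀ (norm_nonneg _) (h i) 2
    _ = (∑ i, c i ^ 2) * s ^ 2 := (Finset.sum_mul _ _ _).symm
    _ ≤ r ^ 2 * s ^ 2 := mul_le_mul_of_nonneg_right hc (sq_nonneg s)

lemma sum_eq_add_sum_Iio {n : ℕ} {α : Type*} [AddCommMonoid α] {f : Fin n → α} {i : Fin n}
    (h : ∀ k, i < k → f k = 0) : ∑ k, f k = f i + ∑ k ∈ Finset.Iio i, f k := by
  rw [← Finset.sum_insert (by simp), Finset.Iio_insert]
  exact (Finset.sum_subset (Finset.subset_univ _) fun k _ hk => h k (by simpa using hk)).symm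

lemma sum_eq_add_sum_Ioi {n : ℕ} {α : Type*} [AddCommMonoid α] {f : Fin n → α} {i : Fin n}
    (h : ∀ k, k < i → f k = 0) : ∑ k, f k = f i + ∑ k ∈ Finset.Ioi i, f k := by
  rw [← Finset.sum_insert (by simp), Finset.Ioi_insert]
  exact (Finset.sum_subset (Finset.subset_univ _) fun k _ hk => h k (by simpa using hk)).symm

/-! ### Perturbation analysis of the Cholesky factorization -/

/-- Row `i` of `R` has a positive pivot satisfying its Cholesky equation up to a relative
error `g`. -/
def PivotResidual {K : ℕ} (C R : Matrix (Fin K) (Fin K) ℂ) (g : ℝ) (i : Fin K) : Prop :=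
  ∃ d : ℝ, 0 < d ∧ R i i = d ∧
    |d ^ 2 + ∑ k ∈ Finset.Iio i, ‖R k i‖ ^ 2 - (C i i).re|
      ≤ g * (d ^ 2 + ∑ k ∈ Finset.Iio i, ‖R k i‖ ^ 2)

/-- The off-diagonal entries of row `i` of `R` satisfy their Cholesky equations up to a relative
error `g`. -/
def RowResidual {K : ℕ} (C R : Matrix (Fin K) (Fin K) ℂ) (g : ℝ) (i : Fin K) : Prop :=
  ∀ j, i < j →
    ‖R i i * R i j + ∑ k ∈ Finset.Iio i, star (R k i) * R k j - C i j‖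
      ≤ g * (‖R i i‖ * ‖R i j‖ + ∑ k ∈ Finset.Iio i, ‖R k i‖ * ‖R k j‖)

section Cholesky

variable {K : ℕ} {A C R : Matrix (Fin K) (Fin K) ℂ} {w : Fin K → ℝ} {g : ℝ}

lemma PivotResidual.vecNorm_sq_sub_le {i : Fin K} (hlow : ∀ k, i < k → R k i = 0)
    (hp : PivotResidual C R g i) :
    |vecNorm (fun k => R k i) ^ 2 - (C i i).re| ≤ g * vecNorm (fun k => R k i) ^ 2 := by
  obtain ⟨d, hd, hR, h⟩ := hp
  have : vecNorm (fun k => R k i) ^ 2 = d ^ 2 + ∑ k ∈ Finset.Iio i, ‖R k i‖ ^ 2 := by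
    rw [vecNorm_sq, sum_eq_add_sum_Iio (i := i) (fun k hk => by rw [hlow k hk]; simp), hR]
    simp
  rwa [this]

lemma re_le_of_norm_sub_le (hA : ∀ i, A i i = ((w i ^ 2 : ℝ) : ℂ))
    (hC : ∀ i j, ‖C i j - A i j‖ ≤ g * (w i * w j)) (i : Fin K) :
    |(C i i).re - w i ^ 2| ≤ g * w i ^ 2 := by
  have h1 := (Complex.abs_re_le_norm _).trans (hC i i)
  rw [hA, Complex.sub_re, Complex.ofReal_re] at h1
  linarith

/-- The pivot equation gives `(1 - g) ‖R_i‖² ≤ Re c_ii ≤ (1 + g) w_i²` for the column `R_i`, and `(1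
+ g) / (1 - g) ≤ 2`. -/
lemma PivotResidual.vecNorm_sq_le {i : Fin K} (hg : g ≤ 1 / 10)
    (hA : ∀ i, A i i = ((w i ^ 2 : ℝ) : ℂ))
    (hC : ∀ i j, ‖C i j - A i j‖ ≤ g * (w i * w j)) (hlow : ∀ k, i < k → R k i = 0)
    (hp : PivotResidual C R g i) : vecNorm (fun k => R k i) ^ 2 ≤ 2 * w i ^ 2 := by
  have h1 := (abs_le.1 (hp.vecNorm_sq_sub_le hlow)).2
  have h2 := (abs_le.1 (re_le_of_norm_sub_le hA hC i)).2
  nlinarith [sq_nonneg (vecNorm (fun k => R k i)), sq_nonneg (w i)]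

lemma gram_apply (R : Matrix (Fin K) (Fin K) ℂ) (i j : Fin K) :
    (R.conjTranspose * R) i j = ∑ k, star (R k i) * R k j := by
  simp [Matrix.mul_apply]

lemma gram_apply_self (R : Matrix (Fin K) (Fin K) ℂ) (i : Fin K) :
    (R.conjTranspose * R) i i = ((vecNorm (fun k => R k i) ^ 2 : ℝ) : ℂ) := by
  rw [gram_apply, vecNorm_sq, Complex.ofReal_sum]
  refine Finset.sum_congr rfl fun k _ => ?_
  rw [Complex.star_def, mul_comm, Complex.mul_conj, Complex.normSq_eq_norm_sq]

lemma norm_gram_sub_le_of_le {i j : Fin K} (hij : i ≤ j) (hg : 0 ≤ g)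
    (hA : ∀ i, A i i = ((w i ^ 2 : ℝ) : ℂ))
    (hC : ∀ i j, ‖C i j - A i j‖ ≤ g * (w i * w j)) (hlow : ∀ k, i < k → R k i = 0)
    (hp : PivotResidual C R g i) (hr : RowResidual C R g i) :
    ‖A i j - (R.conjTranspose * R) i j‖
      ≤ g * (vecNorm (fun k => R k i) * vecNorm (fun k => R k j)) + g * (w i * w j) := by
  rcases hij.eq_or_lt with rfl | hij
  · have h1 := abs_le.1 (hp.vecNorm_sq_sub_le hlow)
    have h2 := abs_le.1 (re_le_of_norm_sub_le hA hC i)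
    rw [hA, gram_apply_self, ← Complex.ofReal_sub, Complex.norm_real, Real.norm_eq_abs, abs_le]
    constructor <;> linarith
  · have h1 := hr j hij
    have h2 := hC i j
    obtain ⟨d, hd, hR, -⟩ := hp
    have h3 : ∑ k, star (R k i) * R k j
        = R i i * R i j + ∑ k ∈ Finset.Iio i, star (R k i) * R k j := by
      rw [sum_eq_add_sum_Iio (i := i) (fun k hk => by rw [hlow k hk]; simp), hR]
      simp
    have h4 : ∑ k, ‖R k i‖ * ‖R k j‖
        = ‖R i i‖ * ‖R i j‖ + ∑ k ∈ Finset.Iio i, ‖R k i‖ * ‖R k j‖ :=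
      sum_eq_add_sum_Iio (i := i) (fun k hk => by rw [hlow k hk]; simp)
    rw [← h3, ← h4] at h1
    have h5 := mul_le_mul_of_nonneg_left
      (sum_norm_mul_norm_le (fun k => R k i) (fun k => R k j)) hg
    rw [gram_apply]
    have h6 : A i j - ∑ k, star (R k i) * R k j
        = -(∑ k, star (R k i) * R k j - C i j) - (C i j - A i j) := by ring
    rw [h6]
    refine (norm_sub_le _ _).trans ?_
    rw [norm_neg]
    linarith

/-- Hermitian symmetry reduces to `i ≤ j`. Only the equations of row `min i j` are used, so the
bound also applies to a factor of which just the first rows are known. -/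
lemma norm_gram_sub_le (i j : Fin K) (hg : 0 ≤ g) (hAh : A.IsHermitian)
    (hA : ∀ i, A i i = ((w i ^ 2 : ℝ) : ℂ))
    (hC : ∀ i j, ‖C i j - A i j‖ ≤ g * (w i * w j)) (hlow : ∀ i k, i < k → R k i = 0)
    (hp : PivotResidual C R g (min i j)) (hr : RowResidual C R g (min i j)) :
    ‖A i j - (R.conjTranspose * R) i j‖
      ≤ g * (vecNorm (fun k => R k i) * vecNorm (fun k => R k j)) + g * (w i * w j) := by
  rcases le_total i j with h | h
  · rw [min_eq_left h] at hp hr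
    exact norm_gram_sub_le_of_le h hg hA hC (hlow i) hp hr
  · rw [min_eq_right h] at hp hr
    have h1 := norm_gram_sub_le_of_le h hg hA hC (hlow j) hp hr
    have hG : (R.conjTranspose * R).IsHermitian := Matrix.isHermitian_conjTranspose_mul_self R
    rw [← hAh.apply i j, ← hG.apply i j, ← star_sub, norm_star, mul_comm (vecNorm _),
      mul_comm (w i)]
    exact h1

/-- A vector in the kernel of the first `i` rows of an upper triangular matrix. -/
lemma exists_kernel_vector (i : Fin K) (hlow : ∀ i k, i < k → R k i = 0)
    (hne : ∀ k < i, R k k ≠ 0) :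
    ∃ z : Fin K → ℂ, z i = 1 ∧ (∀ j, i < j → z j = 0) ∧ ∀ k < i, ∑ j, R k j * z j = 0 := by
  classical
  -- Replacing the rows from `i` on by identity rows gives an invertible upper triangular matrix;
  -- `z` is the solution of `T z = e_i`.
  let T : Matrix (Fin K) (Fin K) ℂ :=
    fun k j => if k < i then R k j else if k = j then 1 else 0
  have hT : T.BlockTriangular id := fun k j (h : j < k) => by
    simp only [T]
    split_ifs with h1 h2
    · exact hlow j k h
    · exact absurd h2 h.ne'
    · rfl
  have hdet : T.det ≠ 0 := by
    rw [Matrix.det_of_isUpperTriangular hT]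
    refine Finset.prod_ne_zero_iff.2 fun k _ => ?_
    simp only [T]
    split_ifs with h1
    · exact hne k h1
    · exact one_ne_zero
  have hu : IsUnit T.det := isUnit_iff_ne_zero.2 hdet
  let z := T⁻¹.mulVec (Pi.single i 1)
  have hz : T.mulVec z = Pi.single i 1 := by
    simp only [z, Matrix.mulVec_mulVec, Matrix.mul_nonsing_inv T hu, Matrix.one_mulVec]
  have hz' : ∀ k, ∑ j, T k j * z j = (Pi.single i 1 : Fin K → ℂ) k := fun k => congrFun hz k
  refine ⟨z, ?_, fun j hj => ?_, fun k hk => ?_⟩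
  · simpa [T] using hz' i
  · simpa [T, hj.not_gt, hj.ne'] using hz' j
  · simpa [T, hk, hk.ne] using hz' k

lemma re_quadForm_eq (A : Matrix (Fin K) (Fin K) ℂ) (z : Fin K → ℂ) :
    (star z ⬝ᵥ A.mulVec z).re = ∑ j, ∑ l, (star (z j) * A j l * z l).re := by
  simp only [dotProduct, Matrix.mulVec, Finset.mul_sum, Complex.re_sum, Pi.star_apply, mul_assoc]

lemma sum_sum_mul_mul (x b : Fin K → ℝ) :
    ∑ j, ∑ l, (x j * x l) * (b j * b l) = (∑ j, x j * b j) ^ 2 := by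
  rw [sq, Finset.sum_mul_sum]
  exact Finset.sum_congr rfl fun j _ => Finset.sum_congr rfl fun l _ => by ring

/-- If the first `i` pivots are accurate and the `i`-th one breaks down, the quadratic form of `A`
is tiny at some nonzero vector. -/
lemma exists_small_quadForm (i : Fin K) (hg0 : 0 ≤ g) (hg : g ≤ 1 / 10) (hw : ∀ j, 0 ≤ w j)
    (hAh : A.IsHermitian) (hA : ∀ i, A i i = ((w i ^ 2 : ℝ) : ℂ))
    (hC : ∀ i j, ‖C i j - A i j‖ ≤ g * (w i * w j)) (hlow : ∀ i k, i < k → R k i = 0)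
    (hp : ∀ k < i, PivotResidual C R g k) (hr : ∀ k < i, RowResidual C R g k)
    (hbad : (C i i).re - ∑ k ∈ Finset.Iio i, ‖R k i‖ ^ 2
      ≤ g * ∑ k ∈ Finset.Iio i, ‖R k i‖ ^ 2) :
    ∃ z : Fin K → ℂ, z i = 1 ∧
      (star z ⬝ᵥ A.mulVec z).re ≤ 7 * g * (∑ j, ‖z j‖ * w j) ^ 2 := by
  classical
  obtain ⟨z, hzi, hzgt, hzker⟩ := exists_kernel_vector (R := R) i hlow fun k hk => by
    obtain ⟨d, hd, hR, -⟩ := hp k hk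
    rw [hR]; exact_mod_cast hd.ne'
  refine ⟨z, hzi, ?_⟩
  -- The part of the factor above row `i`. It annihilates `z`, so the quadratic form of `A` at `z`
  -- equals that of the small matrix `A - Qᴴ Q`.
  let Q : Matrix (Fin K) (Fin K) ℂ := fun k j => if k < i then R k j else 0
  have hQ : ∀ k < i, ∀ j, Q k j = R k j := fun k hk j => if_pos hk
  have hQlow : ∀ i k, i < k → Q k i = 0 := fun j k hjk => by
    simp only [Q, hlow j k hjk, ite_self]
  have hQp : ∀ k < i, PivotResidual C Q g k := fun k hk => by
    obtain ⟨d, hd, hR, h⟩ := hp k hk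
    refine ⟨d, hd, by rw [hQ k hk, hR], ?_⟩
    have : ∑ l ∈ Finset.Iio k, ‖Q l k‖ ^ 2 = ∑ l ∈ Finset.Iio k, ‖R l k‖ ^ 2 :=
      Finset.sum_congr rfl fun l hl => by rw [hQ l ((Finset.mem_Iio.1 hl).trans hk)]
    rwa [this]
  have hQr : ∀ k < i, RowResidual C Q g k := fun k hk j hkj => by
    have h := hr k hk j hkj
    have h1 : ∑ l ∈ Finset.Iio k, star (Q l k) * Q l j
        = ∑ l ∈ Finset.Iio k, star (R l k) * R l j :=
      Finset.sum_congr rfl fun l hl => by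
        rw [hQ l ((Finset.mem_Iio.1 hl).trans hk), hQ l ((Finset.mem_Iio.1 hl).trans hk)]
    have h2 : ∑ l ∈ Finset.Iio k, ‖Q l k‖ * ‖Q l j‖
        = ∑ l ∈ Finset.Iio k, ‖R l k‖ * ‖R l j‖ :=
      Finset.sum_congr rfl fun l hl => by
        rw [hQ l ((Finset.mem_Iio.1 hl).trans hk), hQ l ((Finset.mem_Iio.1 hl).trans hk)]
    rwa [hQ k hk, hQ k hk, h1, h2]
  set b : Fin K → ℝ := fun j => vecNorm (fun k => Q k j) with hb
  have hb0 : ∀ j, 0 ≤ b j := fun j => vecNorm_nonneg _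
  have hbi : b i ^ 2 = ∑ k ∈ Finset.Iio i, ‖R k i‖ ^ 2 := by
    rw [hb, vecNorm_sq, sum_eq_add_sum_Iio (i := i) (fun k hk => by rw [hQlow i k hk]; simp)]
    have : Q i i = 0 := if_neg (lt_irrefl i)
    rw [this, norm_zero, zero_pow two_ne_zero, zero_add]
    exact Finset.sum_congr rfl fun k hk => by rw [hQ k (Finset.mem_Iio.1 hk)]
  set ρ := b i with hρ
  set G := Q.conjTranspose * Q with hG
  have hQz : Q.mulVec z = 0 := by
    funext k
    simp only [Matrix.mulVec, dotProduct, Pi.zero_apply, Q]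
    split_ifs with h
    · exact hzker k h
    · simp
  have hGz : (star z ⬝ᵥ G.mulVec z).re = 0 := by
    rw [hG, ← Matrix.mulVec_mulVec, hQz, Matrix.mulVec_zero, dotProduct_zero, Complex.zero_re]
  have hsub : (star z ⬝ᵥ A.mulVec z).re = (star z ⬝ᵥ (A - G).mulVec z).re := by
    rw [Matrix.sub_mulVec, dotProduct_sub, Complex.sub_re, hGz, sub_zero]
  set W := ∑ j, ‖z j‖ * w j with hW
  -- Indices beyond `i` contribute nothing, as `z` vanishes there. The pair `(i, i)` has no pivot
  -- equation; the indicator term corrects the generic bound to its exact value `w i ^ 2 - ρ ^ 2`.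
  have hterm : ∀ j l, (star (z j) * (A - G) j l * z l).re
      ≤ (g * ((‖z j‖ * ‖z l‖) * (b j * b l)) + g * ((‖z j‖ * ‖z l‖) * (w j * w l)))
        + if j = i then if l = i then (w i ^ 2 - ρ ^ 2 - g * ρ ^ 2 - g * w i ^ 2) else 0
          else 0 := by
    intro j l
    have hnn : 0 ≤ (g * ((‖z j‖ * ‖z l‖) * (b j * b l))
        + g * ((‖z j‖ * ‖z l‖) * (w j * w l))) := by
      have := hb0 j; have := hb0 l; have := hw j; have := hw l
      positivity
    rcases lt_trichotomy (min j l) i with h | h | h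
    · have hE := norm_gram_sub_le j l hg0 hAh hA hC hQlow (hQp _ h) (hQr _ h)
      have hif : (if j = i then if l = i then (w i ^ 2 - ρ ^ 2 - g * ρ ^ 2 - g * w i ^ 2) else 0
          else 0) = 0 := by
        split_ifs with h1 h2
        · subst h1; subst h2; simp at h
        · rfl
        · rfl
      rw [hif, add_zero]
      refine (Complex.re_le_norm _).trans ?_
      rw [norm_mul, norm_mul, norm_star]
      have := mul_le_mul_of_nonneg_left hE (mul_nonneg (norm_nonneg (z j)) (norm_nonneg (z l)))
      rw [Matrix.sub_apply]
      calc _ = ‖z j‖ * ‖z l‖ * ‖A j l - G j l‖ := by ring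
        _ ≤ _ := this
        _ = _ := by ring
    · by_cases hj : j = i
      · by_cases hl : l = i
        · subst hj; subst hl
          rw [if_pos rfl, if_pos rfl, Matrix.sub_apply, hA, hG, gram_apply_self, hzi]
          simp only [star_one, one_mul, mul_one, norm_one, ← Complex.ofReal_sub,
            Complex.ofReal_re]
          apply le_of_eq
          simp only [hρ, hb]
          ring
        · have hl' : i < l := lt_of_le_of_ne (by rw [← h]; exact min_le_right _ _) (Ne.symm hl)
          rw [if_pos hj, if_neg hl, hzgt l hl']
          simp
      · have hj' : i < j := lt_of_le_of_ne (by rw [← h]; exact min_le_left _ _) (Ne.symm hj)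
        rw [if_neg hj, hzgt j hj']
        simp
    · have hj' : i < j := lt_of_lt_of_le h (min_le_left _ _)
      rw [if_neg hj'.ne', hzgt j hj']
      simp
  have hsum : (star z ⬝ᵥ A.mulVec z).re
      ≤ g * (∑ j, ‖z j‖ * b j) ^ 2 + g * W ^ 2
        + (w i ^ 2 - ρ ^ 2 - g * ρ ^ 2 - g * w i ^ 2) := by
    rw [hsub, re_quadForm_eq]
    refine (Finset.sum_le_sum fun j _ => Finset.sum_le_sum fun l _ => hterm j l).trans ?_
    simp only [Finset.sum_add_distrib, ← Finset.mul_sum, sum_sum_mul_mul]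
    simp [Finset.sum_ite_eq', ← hW]
  obtain ⟨B, hB⟩ : ∃ B, B = ∑ j ∈ Finset.univ.erase i, ‖z j‖ * b j := ⟨_, rfl⟩
  obtain ⟨V, hV⟩ : ∃ V, V = ∑ j ∈ Finset.univ.erase i, ‖z j‖ * w j := ⟨_, rfl⟩
  have hBρ : ∑ j, ‖z j‖ * b j = ρ + B := by
    rw [← Finset.add_sum_erase _ _ (Finset.mem_univ i), hzi, norm_one, one_mul, hB]
  have hWV : W = w i + V := by
    rw [hW, ← Finset.add_sum_erase _ _ (Finset.mem_univ i), hzi, norm_one, one_mul, hV]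
  have hB0 : 0 ≤ B := by
    rw [hB]; exact Finset.sum_nonneg fun j _ => mul_nonneg (norm_nonneg _) (hb0 j)
  have hV0 : 0 ≤ V := by
    rw [hV]; exact Finset.sum_nonneg fun j _ => mul_nonneg (norm_nonneg _) (hw j)
  have hBV : B ≤ Real.sqrt 2 * V := by
    rw [hB, hV, Finset.mul_sum]
    refine Finset.sum_le_sum fun j hj => ?_
    rcases lt_or_gt_of_ne (Finset.ne_of_mem_erase hj) with h | h
    · have h1 := (hQp j h).vecNorm_sq_le hg hA hC (hQlow j)
      have h2 : b j ≤ Real.sqrt 2 * w j := by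
        refine abs_le_of_sq_le_sq' ?_ (mul_nonneg (Real.sqrt_nonneg _) (hw j)) |>.2
        rw [mul_pow, Real.sq_sqrt (by norm_num)]
        exact h1
      calc _ ≤ ‖z j‖ * (Real.sqrt 2 * w j) := mul_le_mul_of_nonneg_left h2 (norm_nonneg _)
        _ = _ := by ring
    · rw [hzgt j h]; simp
  have hB2 : B ^ 2 ≤ 2 * V ^ 2 := by
    have := pow_le_pow_left₀ hB0 hBV 2
    rwa [mul_pow, Real.sq_sqrt (by norm_num)] at this
  rw [hBρ] at hsum
  have hcw := (abs_le.1 (re_le_of_norm_sub_le hA hC i)).1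
  rw [← hbi] at hbad
  have hwi := hw i
  have hX1 : w i ^ 2 - ρ ^ 2 - g * w i ^ 2 ≤ g * ρ ^ 2 := by linarith
  have hX2 : w i ^ 2 - ρ ^ 2 - g * w i ^ 2 ≤ w i ^ 2 - ρ ^ 2 := by nlinarith [sq_nonneg (w i)]
  -- Convex combination of `hX1` and `hX2` with weights `1 - 3g` and `3g`, chosen so that `-2 g ρ²`
  -- absorbs the cross term `2 g ρ B` in `hfin`.
  have hX : w i ^ 2 - ρ ^ 2 - g * w i ^ 2 ≤ 3 * g * w i ^ 2 - 2 * g * ρ ^ 2 := by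
    have h1 := mul_le_mul_of_nonneg_left hX1 (by linarith : 0 ≤ 1 - 3 * g)
    have h2 := mul_le_mul_of_nonneg_left hX2 (by linarith : 0 ≤ 3 * g)
    have h3 : 0 ≤ g ^ 2 * ρ ^ 2 := by positivity
    linarith
  have hfin : g * (ρ + B) ^ 2 - g * ρ ^ 2 - 2 * g * ρ ^ 2 ≤ 3 * g * V ^ 2 := by
    have h1 : 0 ≤ g * (2 * V ^ 2 - B ^ 2) := mul_nonneg hg0 (by linarith)
    have h2 : 0 ≤ g * (2 * ρ - B) ^ 2 := mul_nonneg hg0 (sq_nonneg _)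
    linarith
  have h3 : g * (w i ^ 2 + V ^ 2) ≤ g * W ^ 2 := by
    apply mul_le_mul_of_nonneg_left _ hg0
    rw [hWV]; nlinarith
  have h4 : 0 ≤ g * w i ^ 2 := by positivity
  have h5 : 0 ≤ g * V ^ 2 := by positivity
  linarith

/-- The rounded Cholesky factorization does not break down. -/
lemma forall_pivotResidual {T ν : ℝ} (hg0 : 0 ≤ g) (hg : g ≤ 1 / 10) (hw : ∀ j, 0 ≤ w j)
    (hAh : A.IsHermitian) (hA : ∀ i, A i i = ((w i ^ 2 : ℝ) : ℂ))
    (hT : ∑ j, w j ^ 2 ≤ T)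
    (hν0 : 0 ≤ ν) (hν : ∀ z, vecNorm z ^ 2 ≤ ν * (star z ⬝ᵥ A.mulVec z).re)
    (hsmall : 7 * g * T * ν < 1)
    (hC : ∀ i j, ‖C i j - A i j‖ ≤ g * (w i * w j)) (hlow : ∀ i k, i < k → R k i = 0)
    (hp : ∀ i, (C i i).re - ∑ k ∈ Finset.Iio i, ‖R k i‖ ^ 2
      ≤ g * ∑ k ∈ Finset.Iio i, ‖R k i‖ ^ 2 ∨ PivotResidual C R g i)
    (hr : ∀ i, PivotResidual C R g i → RowResidual C R g i) (i : Fin K) :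
    PivotResidual C R g i := by
  induction i using WellFoundedLT.induction with
  | ind i ih =>
    -- At a first bad pivot, coercivity would give `‖z‖² ≤ 7 g T ν ‖z‖²` with `‖z‖ ≥ 1`,
    -- contradicting `hsmall`.
    refine (hp i).resolve_left fun hbad => ?_
    obtain ⟨z, hzi, hz⟩ := exists_small_quadForm i hg0 hg hw hAh hA hC hlow ih
      (fun k hk => hr k (ih k hk)) hbad
    have hT0 : 0 ≤ T := (Finset.sum_nonneg fun j _ => sq_nonneg (w j)).trans hT
    have hW0 : 0 ≤ ∑ j, ‖z j‖ * w j :=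
      Finset.sum_nonneg fun j _ => mul_nonneg (norm_nonneg _) (hw j)
    have hW : (∑ j, ‖z j‖ * w j) ^ 2 ≤ vecNorm z ^ 2 * T := by
      have := sum_mul_le_of_sq_le (vecNorm_nonneg z) (Real.sqrt_nonneg T) (vecNorm_sq z).ge
        (hT.trans (Real.sq_sqrt hT0).ge)
      have := pow_le_pow_left₀ hW0 this 2
      rwa [mul_pow, Real.sq_sqrt hT0] at this
    have hz1 : 1 ≤ vecNorm z := by
      have := norm_apply_le_vecNorm z i
      rwa [hzi, norm_one] at this
    have h1 := (hν z).trans (mul_le_mul_of_nonneg_left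
      (hz.trans (mul_le_mul_of_nonneg_left hW (by linarith : 0 ≤ 7 * g))) hν0)
    have h2 : vecNorm z ^ 2 * (1 - 7 * g * T * ν) ≤ 0 := by linarith
    have h3 : 0 < vecNorm z ^ 2 * (1 - 7 * g * T * ν) :=
      mul_pos (by positivity) (by linarith)
    linarith

/-- Residual of the solution of the normal equations by Cholesky factorization. -/
lemma vecNorm_mulVec_sub_le {T : ℝ} {x q e : Fin K → ℂ} (hg0 : 0 ≤ g) (hg : g ≤ 1 / 10)
    (hw : ∀ j, 0 ≤ w j) (hT0 : 0 ≤ T) (hT : ∑ j, w j ^ 2 ≤ T ^ 2) (hlow : ∀ i k, i < k → R k i = 0)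
    (hcol : ∀ j, vecNorm (fun k => R k j) ^ 2 ≤ 2 * w j ^ 2)
    (hE : ∀ i j, ‖A i j - (R.conjTranspose * R) i j‖
      ≤ g * (vecNorm (fun k => R k i) * vecNorm (fun k => R k j)) + g * (w i * w j))
    (hq : ∀ i, ‖star (R i i) * q i + ∑ k ∈ Finset.Iio i, star (R k i) * q k - x i‖
      ≤ g * (‖R i i‖ * ‖q i‖ + ∑ k ∈ Finset.Iio i, ‖R k i‖ * ‖q k‖))
    (he : ∀ i, ‖R i i * e i + ∑ k ∈ Finset.Ioi i, R i k * e k - q i‖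
      ≤ g * (‖R i i‖ * ‖e i‖ + ∑ k ∈ Finset.Ioi i, ‖R i k‖ * ‖e k‖)) :
    vecNorm (A.mulVec e - x) ≤ 8 * g * T ^ 2 * vecNorm e := by
  have hs2 : Real.sqrt 2 ^ 2 = 2 := Real.sq_sqrt (by norm_num)
  have hs0 := Real.sqrt_nonneg 2
  set S := Real.sqrt 2 with hS
  set n := vecNorm e with hn
  have hn0 : 0 ≤ n := vecNorm_nonneg e
  have hb : ∀ j, vecNorm (fun k => R k j) ≤ S * w j := fun j => by
    refine abs_le_of_sq_le_sq' ?_ (mul_nonneg hs0 (hw j)) |>.2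
    rw [mul_pow, hs2]; exact hcol j
  -- Frobenius norm: the column bounds control the sum of the squared row norms.
  have hF : ∑ i, vecNorm (R i) ^ 2 ≤ (S * T) ^ 2 := by
    calc ∑ i, vecNorm (R i) ^ 2 = ∑ j, vecNorm (fun k => R k j) ^ 2 := by
          simp only [vecNorm_sq]; exact Finset.sum_comm
      _ ≤ ∑ j, 2 * w j ^ 2 := Finset.sum_le_sum fun j _ => hcol j
      _ ≤ (S * T) ^ 2 := by rw [← Finset.mul_sum, mul_pow, hs2]; linarith
  have hST : 0 ≤ S * T := mul_nonneg hs0 hT0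
  set p := R.mulVec e - q with hp
  have hp1 : vecNorm p ≤ S * T * (g * n) := by
    refine vecNorm_le_of_forall hST (mul_nonneg hg0 hn0) hF fun i => ?_
    have h1 : p i = R i i * e i + ∑ k ∈ Finset.Ioi i, R i k * e k - q i := by
      rw [hp, Pi.sub_apply, Matrix.mulVec, dotProduct,
        sum_eq_add_sum_Ioi (i := i) (fun k hk => by rw [hlow k i hk, zero_mul])]
    have h2 : ∑ k, ‖R i k‖ * ‖e k‖ = ‖R i i‖ * ‖e i‖ + ∑ k ∈ Finset.Ioi i, ‖R i k‖ * ‖e k‖ :=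
      sum_eq_add_sum_Ioi (i := i) (fun k hk => by rw [hlow k i hk, norm_zero, zero_mul])
    have h3 := he i
    rw [← h1, ← h2] at h3
    have h4 := mul_le_mul_of_nonneg_left (sum_norm_mul_norm_le (R i) e) hg0
    linarith
  have hRe : vecNorm (R.mulVec e) ≤ S * T * n :=
    vecNorm_le_of_forall hST hn0 hF fun i => norm_sum_mul_le (R i) e
  have hq1 : vecNorm q ≤ S * T * ((1 + g) * n) := by
    have : q = R.mulVec e - p := by rw [hp]; abel
    rw [this]
    refine (vecNorm_sub_le _ _).trans ?_
    linarith
  set f := R.conjTranspose.mulVec q - x with hf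
  have hf1 : ∀ i, ‖f i‖ ≤ g * (S * w i * (S * T * ((1 + g) * n))) := fun i => by
    have h1 : f i = star (R i i) * q i + ∑ k ∈ Finset.Iio i, star (R k i) * q k - x i := by
      rw [hf, Pi.sub_apply, Matrix.mulVec, dotProduct]
      simp only [Matrix.conjTranspose_apply]
      rw [sum_eq_add_sum_Iio (i := i) (fun k hk => by rw [hlow i k hk, star_zero, zero_mul])]
    have h2 : ∑ k, ‖R k i‖ * ‖q k‖ = ‖R i i‖ * ‖q i‖ + ∑ k ∈ Finset.Iio i, ‖R k i‖ * ‖q k‖ :=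
      sum_eq_add_sum_Iio (i := i) (fun k hk => by rw [hlow i k hk, norm_zero, zero_mul])
    have h3 := hq i
    rw [← h1, ← h2] at h3
    refine h3.trans (mul_le_mul_of_nonneg_left ?_ hg0)
    exact (sum_norm_mul_norm_le (fun k => R k i) q).trans
      (mul_le_mul (hb i) hq1 (vecNorm_nonneg q) (mul_nonneg hs0 (hw i)))
  have hRp : ∀ i, ‖R.conjTranspose.mulVec p i‖ ≤ S * w i * (S * T * (g * n)) := fun i => by
    have := norm_sum_star_mul_le (fun k => R k i) p
    exact this.trans (mul_le_mul (hb i) hp1 (vecNorm_nonneg p) (mul_nonneg hs0 (hw i)))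
  set D := A - R.conjTranspose * R with hD
  have hwe : ∑ j, w j * ‖e j‖ ≤ T * n := sum_mul_le_of_sq_le hT0 hn0 hT (vecNorm_sq e).ge
  have hDe : ∀ i, ‖D.mulVec e i‖ ≤ 3 * g * (w i * (T * n)) := fun i => by
    have h1 : ∀ j, ‖D i j‖ ≤ 3 * g * (w i * w j) := fun j => by
      have := mul_le_mul_of_nonneg_left
        (mul_le_mul (hb i) (hb j) (vecNorm_nonneg _) (mul_nonneg hs0 (hw i))) hg0
      have h2 := hE i j
      have h3 : S * w i * (S * w j) = 2 * (w i * w j) := by rw [← hs2]; ring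
      rw [h3] at this
      rw [hD, Matrix.sub_apply]
      linarith
    calc ‖D.mulVec e i‖ ≤ ∑ j, ‖D i j * e j‖ := norm_sum_le Finset.univ fun j => D i j * e j
      _ ≤ ∑ j, 3 * g * w i * (w j * ‖e j‖) := Finset.sum_le_sum fun j _ => by
          rw [norm_mul]
          have := mul_le_mul_of_nonneg_right (h1 j) (norm_nonneg (e j))
          linarith
      _ = 3 * g * w i * ∑ j, w j * ‖e j‖ := (Finset.mul_sum _ _ _).symm
      _ ≤ 3 * g * w i * (T * n) :=
          mul_le_mul_of_nonneg_left hwe (mul_nonneg (by linarith) (hw i))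
      _ = _ := by ring
  -- The residual splits into the errors of the forward solve, the backward solve and the
  -- factorization. Their constants `2 (1 + g)`, `2` and `3` add up to at most `8`.
  have hres : A.mulVec e - x = f + R.conjTranspose.mulVec p + D.mulVec e := by
    rw [hf, hp, hD, Matrix.mulVec_sub, Matrix.sub_mulVec, Matrix.mulVec_mulVec]
    abel
  have hfinal : ∀ i, ‖(A.mulVec e - x) i‖ ≤ w i * (8 * g * T * n) := fun i => by
    have h1 : S * w i * (S * T * ((1 + g) * n)) = 2 * (w i * (T * ((1 + g) * n))) := by
      rw [← hs2]; ring
    have h2 : S * w i * (S * T * (g * n)) = 2 * (w i * (T * (g * n))) := by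
      rw [← hs2]; ring
    have h3 := hf1 i
    have h4 := hRp i
    rw [h1] at h3
    rw [h2] at h4
    have h5 : ‖(A.mulVec e - x) i‖ ≤ ‖f i‖ + ‖R.conjTranspose.mulVec p i‖ + ‖D.mulVec e i‖ := by
      rw [hres]
      exact norm_add₃_le
    have h6 := hDe i
    have h7 : 0 ≤ w i * (T * n) := mul_nonneg (hw i) (mul_nonneg hT0 hn0)
    have h8 : 0 ≤ g * (w i * (T * n)) * (1 / 10 - g) :=
      mul_nonneg (mul_nonneg hg0 h7) (by linarith)
    have h9 : 0 ≤ g * (w i * (T * n)) := mul_nonneg hg0 h7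
    linarith
  have h0 : 0 ≤ 8 * g * T * n := by positivity
  have := vecNorm_le_of_forall hT0 h0 hT hfinal
  linarith

end Cholesky

/-! ### The rounded algorithm satisfies the residual bounds -/

lemma sum_fin_val_eq_sum_Iio {K : ℕ} {α : Type*} [AddCommMonoid α] (i : Fin K) (f : Fin K → α) :
    ∑ k : Fin i.val, f ⟨k.val, k.isLt.trans i.isLt⟩ = ∑ k ∈ Finset.Iio i, f k := by
  refine Finset.sum_bij (fun k _ => ⟨k.val, k.isLt.trans i.isLt⟩) ?_ ?_ ?_ ?_
  · intro k _
    exact Finset.mem_Iio.2 k.isLt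
  · intro a _ b _ h
    exact Fin.ext (Fin.mk.inj h)
  · intro k hk
    exact ⟨⟨k.val, Fin.lt_def.1 (Finset.mem_Iio.1 hk)⟩, Finset.mem_univ _, rfl⟩
  · intro k _
    rfl

lemma sum_fin_sub_eq_sum_Ioi {K : ℕ} {α : Type*} [AddCommMonoid α] (i : Fin K) (f : Fin K → α) :
    ∑ k : Fin (K - (i.val + 1)), f ⟨i.val + 1 + k.val, by omega⟩
      = ∑ k ∈ Finset.Ioi i, f k := by
  refine Finset.sum_bij (fun k _ => ⟨i.val + 1 + k.val, by omega⟩) ?_ ?_ ?_ ?_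
  · intro k _
    rw [Finset.mem_Ioi, Fin.lt_def]
    simp only
    omega
  · intro a _ b _ h
    have := Fin.mk.inj h
    exact Fin.ext (by omega)
  · intro k hk
    have h1 : i.val < k.val := Fin.lt_def.1 (Finset.mem_Ioi.1 hk)
    exact ⟨⟨k.val - (i.val + 1), by omega⟩, Finset.mem_univ _, Fin.ext (by simp only; omega)⟩
  · intro k _
    rfl

section Algorithm

variable {K : ℕ} (δ : RoundOp → ℝ) (C R : Matrix (Fin K) (Fin K) ℂ)

lemma flChol_of_lt {i j : Fin K} (h : j < i) : flChol δ C i j = 0 := by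
  rw [flChol]
  simp [h]

lemma flChol_self (i : Fin K) :
    flChol δ C i i = ((rnd (errAt δ .chol i i .re .root 0) (Real.sqrt
      (flSubInner (errAt δ .chol i i) (C i i)
        (fun k : Fin i.val => flChol δ C ⟨k.val, k.isLt.trans i.isLt⟩ i)
        (fun k : Fin i.val => flChol δ C ⟨k.val, k.isLt.trans i.isLt⟩ i)).re) : ℝ) : ℂ) := by
  rw [flChol]
  simp

lemma flChol_of_gt {i j : Fin K} (h : i < j) :
    flChol δ C i j = flDivReal (errAt δ .chol i j)
      (flSubInner (errAt δ .chol i j) (C i j)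
        (fun k : Fin i.val => flChol δ C ⟨k.val, k.isLt.trans i.isLt⟩ i)
        (fun k : Fin i.val => flChol δ C ⟨k.val, k.isLt.trans i.isLt⟩ j))
      (flChol δ C i i).re := by
  rw [flChol_self, Complex.ofReal_re]
  conv_lhs => rw [flChol]
  simp [h.not_gt, h.ne']

variable {δ C R} {N : ℕ} {t : ℝ}

lemma flChol_pivot {i : Fin K} (h : SmallErrors (errAt δ .chol i i) N t) (hN : i.val + i.val ≤ N) :
    (C i i).re - ∑ k ∈ Finset.Iio i, ‖flChol δ C k i‖ ^ 2
        ≤ 20 * t * ∑ k ∈ Finset.Iio i, ‖flChol δ C k i‖ ^ 2 ∨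
      PivotResidual C (flChol δ C) (20 * t) i := by
  have hs := sum_fin_val_eq_sum_Iio i (fun k => ‖flChol δ C k i‖ ^ 2)
  have ht := h.nonneg
  have hS : 0 ≤ ∑ k ∈ Finset.Iio i, ‖flChol δ C k i‖ ^ 2 :=
    Finset.sum_nonneg fun _ _ => sq_nonneg _
  rcases flSubInner_sqrt_pivot h hN (C i i)
    (fun k : Fin i.val => flChol δ C ⟨k.val, k.isLt.trans i.isLt⟩ i) with h1 | ⟨h1, h2⟩
  · left
    rw [hs] at h1
    have := mul_nonneg ht hS
    linarith
  · right
    rw [hs] at h2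
    refine ⟨_, h1, flChol_self δ C i, h2.trans ?_⟩
    exact mul_le_mul_of_nonneg_right (by linarith) (add_nonneg (sq_nonneg _) hS)

lemma flChol_row {i : Fin K} (h : ∀ j : Fin K, SmallErrors (errAt δ .chol i j) N t)
    (hN : i.val + i.val ≤ N) {d : ℝ} (hd : 0 < d) (hR : flChol δ C i i = d) :
    RowResidual C (flChol δ C) (20 * t) i := by
  intro j hij
  have h1 := norm_flDivReal_flSubInner_residual_le (h j) hN (C i j)
    (fun k : Fin i.val => flChol δ C ⟨k.val, k.isLt.trans i.isLt⟩ i)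
    (fun k : Fin i.val => flChol δ C ⟨k.val, k.isLt.trans i.isLt⟩ j) hd.ne'
  have h2 := flChol_of_gt δ C hij
  rw [hR, Complex.ofReal_re] at h2
  rw [← h2, ← hR, sum_fin_val_eq_sum_Iio i (fun k => star (flChol δ C k i) * flChol δ C k j),
    sum_fin_val_eq_sum_Iio i (fun k => ‖flChol δ C k i‖ * ‖flChol δ C k j‖)] at h1
  exact h1

lemma flForward_residual {x : Fin K → ℂ} {i : Fin K}
    (h : SmallErrors (errAt δ .forward i 0) N t) (hN : i.val + i.val ≤ N)
    {d : ℝ} (hd : 0 < d) (hR : R i i = d) :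
    ‖star (R i i) * flForward δ R x i + ∑ k ∈ Finset.Iio i, star (R k i) * flForward δ R x k
        - x i‖
      ≤ 20 * t * (‖R i i‖ * ‖flForward δ R x i‖
        + ∑ k ∈ Finset.Iio i, ‖R k i‖ * ‖flForward δ R x k‖) := by
  have h1 := norm_flDivReal_flSubInner_residual_le h hN (x i)
    (fun k : Fin i.val => R ⟨k.val, k.isLt.trans i.isLt⟩ i)
    (fun k : Fin i.val => flForward δ R x ⟨k.val, k.isLt.trans i.isLt⟩) hd.ne'
  have h2 := flForward.eq_1 δ R x i
  rw [hR, Complex.ofReal_re] at h2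
  rw [← h2, sum_fin_val_eq_sum_Iio i (fun k => star (R k i) * flForward δ R x k),
    sum_fin_val_eq_sum_Iio i (fun k => ‖R k i‖ * ‖flForward δ R x k‖)] at h1
  rw [hR, Complex.star_def, Complex.conj_ofReal]
  exact h1

lemma flBackward_residual {q : Fin K → ℂ} {i : Fin K}
    (h : SmallErrors (errAt δ .backward i 0) N t) (hN : K + K ≤ N)
    {d : ℝ} (hd : 0 < d) (hR : R i i = d) :
    ‖R i i * flBackward δ R q i + ∑ k ∈ Finset.Ioi i, R i k * flBackward δ R q k - q i‖
      ≤ 20 * t * (‖R i i‖ * ‖flBackward δ R q i‖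
        + ∑ k ∈ Finset.Ioi i, ‖R i k‖ * ‖flBackward δ R q k‖) := by
  have h1 := norm_flDivReal_flSubInner_residual_le h
    (show K - (i.val + 1) + (K - (i.val + 1)) ≤ N by omega) (q i)
    (fun k : Fin (K - (i.val + 1)) => star (R i ⟨i.val + 1 + k.val, by omega⟩))
    (fun k : Fin (K - (i.val + 1)) => flBackward δ R q ⟨i.val + 1 + k.val, by omega⟩) hd.ne'
  have h2 := flBackward.eq_1 δ R q i
  rw [hR, Complex.ofReal_re] at h2
  simp only [star_star, norm_star] at h1
  rw [← h2, sum_fin_sub_eq_sum_Ioi i (fun k => R i k * flBackward δ R q k),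
    sum_fin_sub_eq_sum_Ioi i (fun k => ‖R i k‖ * ‖flBackward δ R q k‖)] at h1
  rw [hR]
  exact h1

end Algorithm

/-- All rounding errors used by the algorithm are small: with tolerance `s` in the computation of
the Gram matrix and `t` in the other stages. -/
structure SmallSample (δ : RoundOp → ℝ) (M K : ℕ) (s t : ℝ) : Prop where
  gram : ∀ i < K, ∀ j < K, SmallErrors (errAt δ .gram i j) (2 * M) s
  chol : ∀ i < K, ∀ j < K, SmallErrors (errAt δ .chol i j) (2 * K) t
  forward : ∀ i < K, SmallErrors (errAt δ .forward i 0) (2 * K) t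
  backward : ∀ i < K, SmallErrors (errAt δ .backward i 0) (2 * K) t
  product : ∀ i < M, SmallErrors (errAt δ .product i 0) (2 * K) t

lemma RowResidual.mono {K : ℕ} {C R : Matrix (Fin K) (Fin K) ℂ} {g g' : ℝ} {i : Fin K}
    (hg : g ≤ g') (h : RowResidual C R g i) : RowResidual C R g' i := fun j hij =>
  (h j hij).trans (mul_le_mul_of_nonneg_right hg (by positivity))

lemma PivotResidual.mono {K : ℕ} {C R : Matrix (Fin K) (Fin K) ℂ} {g g' : ℝ} {i : Fin K}
    (hg : g ≤ g') (h : PivotResidual C R g i) : PivotResidual C R g' i := by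
  obtain ⟨d, hd, hR, h⟩ := h
  exact ⟨d, hd, hR, h.trans (mul_le_mul_of_nonneg_right hg (by positivity))⟩

/-- Residual of the computed solution of the normal equations. -/
lemma vecNorm_flNESolution_residual_le {M K : ℕ} {δ : RoundOp → ℝ} {s t T ν : ℝ}
    (h : SmallSample δ M K s t) (hs0 : 0 ≤ s) (ht0 : 0 ≤ t) (hst : 20 * (s + t) ≤ 1 / 10)
    (H : Matrix (Fin M) (Fin K) ℂ) (x : Fin K → ℂ) (hT0 : 0 ≤ T)
    (hT : ∑ j, vecNorm (fun k => H k j) ^ 2 ≤ T ^ 2) (hν0 : 0 ≤ ν)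
    (hν : ∀ z, vecNorm z ^ 2 ≤ ν * (star z ⬝ᵥ (H.conjTranspose * H).mulVec z).re)
    (hsmall : 7 * (20 * (s + t)) * T ^ 2 * ν < 1) :
    vecNorm ((H.conjTranspose * H).mulVec (flNESolution δ H x) - x)
      ≤ 8 * (20 * (s + t)) * T ^ 2 * vecNorm (flNESolution δ H x) := by
  -- A single tolerance for all stages: `20 s` bounds the Gram errors and `20 t` those of the later
  -- stages.
  set g := 20 * (s + t) with hg
  have hg0 : 0 ≤ g := by rw [hg]; linarith
  have htg : 20 * t ≤ g := by rw [hg]; linarith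
  have hsg : 20 * s ≤ g := by rw [hg]; linarith
  set C := flMatMul δ .gram H.conjTranspose H with hCdef
  set R : Matrix (Fin K) (Fin K) ℂ := flChol δ C with hRdef
  have hw : ∀ j : Fin K, 0 ≤ vecNorm (fun k => H k j) := fun j => vecNorm_nonneg _
  have hAh := Matrix.isHermitian_conjTranspose_mul_self H
  have hA : ∀ i, (H.conjTranspose * H) i i = ((vecNorm (fun k => H k i) ^ 2 : ℝ) : ℂ) := fun i => by
    rw [Matrix.mul_apply, vecNorm_sq, Complex.ofReal_sum]
    refine Finset.sum_congr rfl fun k _ => ?_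
    rw [Matrix.conjTranspose_apply, Complex.star_def, mul_comm, Complex.mul_conj,
      Complex.normSq_eq_norm_sq]
  have hC : ∀ i j, ‖C i j - (H.conjTranspose * H) i j‖
      ≤ g * (vecNorm (fun k => H k i) * vecNorm (fun k => H k j)) := fun i j => by
    have h1 := norm_flInner_sub_le (h.gram i i.isLt j j.isLt) (by omega : M + M ≤ 2 * M)
      (fun k => star (H.conjTranspose i k)) (fun k => H k j)
    have h2 : (H.conjTranspose * H) i j
        = ∑ k, star (star (H.conjTranspose i k)) * H k j := by
      simp [Matrix.mul_apply]
    rw [h2]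
    refine h1.trans (mul_le_mul hsg ?_ (by positivity) hg0)
    simp only [Matrix.conjTranspose_apply, star_star]
    exact sum_norm_mul_norm_le (fun k => H k i) (fun k => H k j)
  have hlow : ∀ i k, i < k → R k i = 0 := fun i k hik => flChol_of_lt δ C hik
  have hi2 : ∀ i : Fin K, i.val + i.val ≤ 2 * K := fun i => by have := i.isLt; omega
  have hpiv0 : ∀ i, (C i i).re - ∑ k ∈ Finset.Iio i, ‖R k i‖ ^ 2
      ≤ 20 * t * ∑ k ∈ Finset.Iio i, ‖R k i‖ ^ 2 ∨ PivotResidual C R (20 * t) i := fun i =>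
    flChol_pivot (h.chol i i.isLt i i.isLt) (hi2 i)
  have hp : ∀ i, (C i i).re - ∑ k ∈ Finset.Iio i, ‖R k i‖ ^ 2
      ≤ g * ∑ k ∈ Finset.Iio i, ‖R k i‖ ^ 2 ∨ PivotResidual C R g i := fun i =>
    (hpiv0 i).imp (fun h => h.trans (mul_le_mul_of_nonneg_right htg (by positivity)))
      (PivotResidual.mono htg)
  have hr : ∀ i, PivotResidual C R g i → RowResidual C R g i := fun i hpi => by
    obtain ⟨d, hd, hR, -⟩ := hpi
    exact (flChol_row (fun j => h.chol i i.isLt j j.isLt) (hi2 i) hd hR).mono htg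
  have hpiv := forall_pivotResidual hg0 hst hw hAh hA hT hν0 hν hsmall hC hlow hp hr
  have hcol : ∀ j, vecNorm (fun k => R k j) ^ 2 ≤ 2 * vecNorm (fun k => H k j) ^ 2 := fun j =>
    (hpiv j).vecNorm_sq_le hst hA hC (hlow j)
  refine vecNorm_mulVec_sub_le (q := flForward δ R x) hg0 hst hw hT0 hT hlow hcol
    (fun i j => norm_gram_sub_le i j hg0 hAh hA hC hlow (hpiv _) (hr _ (hpiv _))) ?_ ?_
  · intro i
    obtain ⟨d, hd, hR, -⟩ := hpiv i
    exact (flForward_residual (h.forward i i.isLt) (hi2 i) hd hR).trans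
      (mul_le_mul_of_nonneg_right htg (by positivity))
  · intro i
    obtain ⟨d, hd, hR, -⟩ := hpiv i
    exact (flBackward_residual (h.backward i i.isLt) (by omega) hd hR).trans
      (mul_le_mul_of_nonneg_right htg (by positivity))

/-- Rounding error of the final matrix-vector product. -/
lemma vecNorm_flMulVec_sub_le {M K : ℕ} {δ : RoundOp → ℝ} {s t T : ℝ}
    (h : SmallSample δ M K s t) (ht0 : 0 ≤ t) (H : Matrix (Fin M) (Fin K) ℂ) (hT0 : 0 ≤ T)
    (hT : ∑ j, vecNorm (fun k => H k j) ^ 2 ≤ T ^ 2) (e : Fin K → ℂ) :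
    vecNorm (flMulVec δ .product H e - H.mulVec e) ≤ 20 * t * T * vecNorm e := by
  have hF : ∑ i, vecNorm (H i) ^ 2 ≤ T ^ 2 := by
    refine le_trans (le_of_eq ?_) hT
    simp only [vecNorm_sq]
    exact Finset.sum_comm
  have h1 : vecNorm (flMulVec δ .product H e - H.mulVec e) ≤ T * (20 * t * vecNorm e) := by
    refine vecNorm_le_of_forall hT0 (mul_nonneg (by linarith) (vecNorm_nonneg e)) hF fun i => ?_
    have h2 := norm_flInner_sub_le (h.product i i.isLt) (by omega : K + K ≤ 2 * K)
      (fun k => star (H i k)) e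
    simp only [star_star, norm_star] at h2
    have h3 := mul_le_mul_of_nonneg_left (sum_norm_mul_norm_le (H i) e)
      (by linarith : 0 ≤ 20 * t)
    have h4 : vecNorm (H i) * (20 * t * vecNorm e) = 20 * t * (vecNorm (H i) * vecNorm e) := by
      ring
    rw [h4]
    exact h2.trans h3
  linarith

/-! ### Concentration of the prefix sums -/

section Probability

variable {Ω : Type*} [MeasurableSpace Ω] {P : Measure Ω} [IsProbabilityMeasure P] {u : ℝ}
  {δ : RoundOp → Ω → ℝ}

/-- Hoeffding's lemma on `[-u, u]`, whose half-width is `u`. -/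
lemma RoundingModel.hasSubgaussianMGF (h : RoundingModel P u δ) (o : RoundOp) :
    HasSubgaussianMGF (δ o) (‖u‖₊ ^ 2) P := by
  have h1 := hasSubgaussianMGF_of_mem_Icc_of_integral_eq_zero (a := -u) (b := u)
    (h.measurable o).aemeasurable (ae_of_all _ fun ω => _root_.abs_le.1 (h.abs_le o ω)) (h.mean_zero o)
  have h2 : ‖u - -u‖₊ / 2 = ‖u‖₊ := by
    rw [sub_neg_eq_add, ← two_mul, nnnorm_mul]
    simp
  rwa [h2] at h1

lemma hoeffding_exponent_le {N m : ℕ} (hm : 0 < m) (hmN : m ≤ N) (hu : 0 < u) (l : ℝ) :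
    -(l * Real.sqrt N * u) ^ 2 / (2 * m * u ^ 2) ≤ -(l ^ 2 / 2) := by
  have hm' : (0 : ℝ) < m := by exact_mod_cast hm
  have hmN' : (m : ℝ) ≤ N := by exact_mod_cast hmN
  rw [div_le_iff₀ (by positivity), mul_pow, mul_pow, Real.sq_sqrt (by positivity)]
  have : 0 ≤ l ^ 2 * u ^ 2 * (N - m) := mul_nonneg (by positivity) (by linarith)
  linarith

/-- Hoeffding's inequality for `X` and for `-X`. The threshold uses `N` instead of `m`, so one
tolerance serves every prefix length `m ≤ N`. -/
lemma measureReal_abs_sum_range_ge_le {X : ℕ → Ω → ℝ} {N m : ℕ} {l : ℝ} (hX : iIndepFun X P)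
    (hsub : ∀ i, HasSubgaussianMGF (X i) (‖u‖₊ ^ 2) P)
    (hm : 0 < m) (hmN : m ≤ N) (hu : 0 < u) (hl : 0 ≤ l) :
    P.real {ω | l * Real.sqrt N * u ≤ |∑ k ∈ Finset.range m, X k ω|}
      ≤ 2 * Real.exp (-(l ^ 2 / 2)) := by
  have ha : 0 ≤ l * Real.sqrt N * u := by positivity
  have hle := Real.exp_le_exp.2 (hoeffding_exponent_le hm hmN hu l)
  have hu2 : ((‖u‖₊ ^ 2 : NNReal) : ℝ) = u ^ 2 := by simp
  have h1 := HasSubgaussianMGF.measure_sum_range_ge_le_of_iIndepFun hX (n := m)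
    (fun i _ => hsub i) ha
  have hX' : iIndepFun (fun i => -X i) P := hX.comp (fun _ x => -x) fun _ => measurable_neg
  have h2 := HasSubgaussianMGF.measure_sum_range_ge_le_of_iIndepFun hX' (n := m)
    (fun i _ => (hsub i).neg) ha
  rw [hu2] at h1 h2
  have hsubset : {ω | l * Real.sqrt N * u ≤ |∑ k ∈ Finset.range m, X k ω|}
      ⊆ {ω | l * Real.sqrt N * u ≤ ∑ k ∈ Finset.range m, X k ω}
        ∪ {ω | l * Real.sqrt N * u ≤ ∑ k ∈ Finset.range m, (-X k) ω} := fun ω hω => by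
    simp only [Set.mem_union, Set.mem_ofPred_eq, Pi.neg_apply, Finset.sum_neg_distrib] at hω ⊢
    exact le_abs.1 hω
  have h3 := (measureReal_mono hsubset (μ := P)).trans (measureReal_union_le _ _)
  linarith

/-- Some prefix sum of the addition errors of one entry is large. -/
def largePrefix (δ : RoundOp → Ω → ℝ) (u l : ℝ) (N : ℕ) (t : Stage) (i j : ℕ) : Set Ω :=
  {ω | ∃ p : Part, ∃ m ∈ Finset.Icc 1 N,
    l * Real.sqrt N * u ≤ |∑ k ∈ Finset.range m, δ ⟨t, i, j, p, .add, k⟩ ω|}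

/-- Union bound: two parts, `N` prefixes and two tails make the factor `4 N`. -/
lemma RoundingModel.measureReal_largePrefix_le (h : RoundingModel P u δ) (hu : 0 < u) {l : ℝ}
    (hl : 0 ≤ l) (N : ℕ) (t : Stage) (i j : ℕ) :
    P.real (largePrefix δ u l N t i j) ≤ 4 * N * Real.exp (-(l ^ 2 / 2)) := by
  let S : Part → ℕ → Set Ω := fun p m =>
    {ω | l * Real.sqrt N * u ≤ |∑ k ∈ Finset.range m, δ ⟨t, i, j, p, .add, k⟩ ω|}
  have hS : ∀ p, ∀ m ∈ Finset.Icc 1 N, P.real (S p m) ≤ 2 * Real.exp (-(l ^ 2 / 2)) := by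
    intro p m hm
    obtain ⟨hm1, hm2⟩ := Finset.mem_Icc.1 hm
    have hinj : Function.Injective fun k : ℕ => (⟨t, i, j, p, .add, k⟩ : RoundOp) :=
      fun a b hab => (RoundOp.mk.inj hab).2.2.2.2.2
    exact measureReal_abs_sum_range_ge_le (h.indep.precomp hinj)
      (fun k => h.hasSubgaussianMGF _) hm1 hm2 hu hl
  have hU : ∀ p, P.real (⋃ m ∈ Finset.Icc 1 N, S p m) ≤ N * (2 * Real.exp (-(l ^ 2 / 2))) := by
    intro p
    refine (measureReal_biUnion_finset_le _ _).trans ((Finset.sum_le_sum (hS p)).trans ?_)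
    simp
  have hsub : largePrefix δ u l N t i j
      ⊆ (⋃ m ∈ Finset.Icc 1 N, S .re m) ∪ ⋃ m ∈ Finset.Icc 1 N, S .im m := by
    rintro ω ⟨p, m, hm, hω⟩
    cases p
    · exact Or.inl (Set.mem_biUnion hm hω)
    · exact Or.inr (Set.mem_biUnion hm hω)
  have := (measureReal_mono hsub (μ := P)).trans (measureReal_union_le _ _)
  have := hU .re
  have := hU .im
  linarith

lemma RoundingModel.measureReal_iUnion_largePrefix_le (h : RoundingModel P u δ) (hu : 0 < u)
    {l : ℝ} (hl : 0 ≤ l) (N a b : ℕ) (t : Stage) :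
    P.real (⋃ i ∈ Finset.range a, ⋃ j ∈ Finset.range b, largePrefix δ u l N t i j)
      ≤ a * b * (4 * N * Real.exp (-(l ^ 2 / 2))) := by
  refine (measureReal_biUnion_finset_le _ _).trans ?_
  refine (Finset.sum_le_sum (g := fun _ => b * (4 * N * Real.exp (-(l ^ 2 / 2))))
    fun i _ => ?_).trans (by simp [mul_assoc])
  refine (measureReal_biUnion_finset_le _ _).trans ?_
  refine (Finset.sum_le_sum fun j _ => h.measureReal_largePrefix_le hu hl N t i j).trans ?_
  simp

/-- Some prefix sum of the addition errors used by the algorithm is large. -/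
def badEvent (δ : RoundOp → Ω → ℝ) (u l : ℝ) (M K : ℕ) : Set Ω :=
  ((((⋃ i ∈ Finset.range K, ⋃ j ∈ Finset.range K, largePrefix δ u l (2 * M) .gram i j)
  ∪ (⋃ i ∈ Finset.range K, ⋃ j ∈ Finset.range K, largePrefix δ u l (2 * K) .chol i j))
  ∪ (⋃ i ∈ Finset.range K, ⋃ j ∈ Finset.range 1, largePrefix δ u l (2 * K) .forward i j))
  ∪ (⋃ i ∈ Finset.range K, ⋃ j ∈ Finset.range 1, largePrefix δ u l (2 * K) .backward i j))
  ∪ (⋃ i ∈ Finset.range M, ⋃ j ∈ Finset.range 1, largePrefix δ u l (2 * K) .product i j)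

/-- The five stages contribute `8MK²`, `8K³`, `8K²`, `8K²` and `8MK`; each is at most `8MK²` because
`1 ≤ K ≤ M`. -/
lemma RoundingModel.measureReal_badEvent_le (h : RoundingModel P u δ) (hu : 0 < u) {l : ℝ}
    (hl : 0 ≤ l) {M K : ℕ} (hK : 0 < K) (hKM : K ≤ M) :
    P.real (badEvent δ u l M K) ≤ 40 * (M * K ^ 2) * Real.exp (-(l ^ 2 / 2)) := by
  have h1 := h.measureReal_iUnion_largePrefix_le hu hl (2 * M) K K .gram
  have h2 := h.measureReal_iUnion_largePrefix_le hu hl (2 * K) K K .chol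
  have h3 := h.measureReal_iUnion_largePrefix_le hu hl (2 * K) K 1 .forward
  have h4 := h.measureReal_iUnion_largePrefix_le hu hl (2 * K) K 1 .backward
  have h5 := h.measureReal_iUnion_largePrefix_le hu hl (2 * K) M 1 .product
  have h6 : P.real (badEvent δ u l M K) ≤ _ :=
    (measureReal_union_le _ _).trans (add_le_add_left ((measureReal_union_le _ _).trans
      (add_le_add_left ((measureReal_union_le _ _).trans
        (add_le_add_left (measureReal_union_le _ _) _)) _)) _)
  push_cast at h1 h2 h3 h4 h5
  set E := Real.exp (-(l ^ 2 / 2)) with hE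
  have hE0 : 0 < E := Real.exp_pos _
  have hK1 : (1 : ℝ) ≤ K := by exact_mod_cast hK
  have hKM' : (K : ℝ) ≤ M := by exact_mod_cast hKM
  have e1 : (K : ℝ) ^ 3 ≤ M * K ^ 2 := by nlinarith [sq_nonneg (K : ℝ)]
  have e2 : (K : ℝ) ^ 2 ≤ M * K ^ 2 := by nlinarith [sq_nonneg (K : ℝ)]
  have e3 : (M : ℝ) * K ≤ M * K ^ 2 := by
    apply mul_le_mul_of_nonneg_left _ (by positivity); nlinarith
  have f1 := mul_le_mul_of_nonneg_right e1 hE0.le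
  have f2 := mul_le_mul_of_nonneg_right e2 hE0.le
  have f3 := mul_le_mul_of_nonneg_right e3 hE0.le
  linarith

end Probability

lemma smallErrors_of_notMem_largePrefix {Ω : Type*} [MeasurableSpace Ω] {P : Measure Ω} {u : ℝ}
    {δ : RoundOp → Ω → ℝ} (h : RoundingModel P u δ) (hu : 0 < u) {l t : ℝ} {N : ℕ} {ω : Ω}
    {s : Stage} {i j : ℕ} (hω : ω ∉ largePrefix δ u l N s i j) (ht : l * Real.sqrt N * u = t)
    (ht1 : t ≤ 1 / 100) (hut : u ≤ t) (hNt : N * u ^ 2 ≤ t) :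
    SmallErrors (errAt (fun o => δ o ω) s i j) N t where
  small := ht1
  error_le p o k := (h.abs_le _ ω).trans hut
  prefix_le p k hk := by
    refine abs_prefixProd_sub_one_le (fun j => h.abs_le _ ω) hk ?_ hNt (by linarith) (by linarith)
    -- The empty prefix is not covered by `largePrefix`, but its sum is zero.
    rcases Nat.eq_zero_or_pos k with rfl | hk0
    · simpa using hu.le.trans hut
    · by_contra hcon
      push Not at hcon
      exact hω ⟨p, k, Finset.mem_Icc.2 ⟨hk0, hk⟩, ht.le.trans hcon.le⟩

/-! ### Spectral norm and the Gram matrix -/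

section Gram

variable {M K : ℕ} (H : Matrix (Fin M) (Fin K) ℂ)

lemma specNorm_nonneg : 0 ≤ specNorm H := by
  open scoped Matrix.Norms.L2Operator in exact norm_nonneg H

lemma vecNorm_mulVec_le (v : Fin K → ℂ) : vecNorm (H.mulVec v) ≤ specNorm H * vecNorm v := by
  open scoped Matrix.Norms.L2Operator in exact H.l2_opNorm_mulVec (WithLp.toLp 2 v)

lemma specNorm_gram : specNorm (H.conjTranspose * H) = specNorm H ^ 2 := by
  rw [sq]
  open scoped Matrix.Norms.L2Operator in exact Matrix.l2_opNorm_conjTranspose_mul_self H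

lemma vecNorm_single (j : Fin K) : vecNorm (Pi.single j 1) = 1 := by
  rw [← sq_eq_sq₀ (vecNorm_nonneg _) zero_le_one, vecNorm_sq, Finset.sum_eq_single j]
  · simp
  · intro i _ hij
    simp [hij]
  · simp

/-- Each of the `K` columns is the image of a unit vector. This is where the dimension factor `K` in
the bound comes from. -/
lemma sum_vecNorm_col_sq_le :
    ∑ j, vecNorm (fun k => H k j) ^ 2 ≤ (Real.sqrt K * specNorm H) ^ 2 := by
  rw [mul_pow, Real.sq_sqrt (Nat.cast_nonneg K)]
  refine (Finset.sum_le_sum (g := fun _ => specNorm H ^ 2) fun j _ => ?_).trans (by simp)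
  have h := vecNorm_mulVec_le H (Pi.single j 1)
  rw [vecNorm_single, mul_one, Matrix.mulVec_single_one] at h
  exact pow_le_pow_left₀ (vecNorm_nonneg _) h 2

lemma quadForm_gram (z : Fin K → ℂ) :
    star z ⬝ᵥ (H.conjTranspose * H).mulVec z = ((vecNorm (H.mulVec z) ^ 2 : ℝ) : ℂ) := by
  rw [← Matrix.mulVec_mulVec, Matrix.dotProduct_mulVec, Matrix.vecMul_conjTranspose, star_star,
    vecNorm_sq, Complex.ofReal_sum, dotProduct]
  refine Finset.sum_congr rfl fun k _ => ?_
  rw [Pi.star_apply, Complex.star_def, mul_comm, Complex.mul_conj, Complex.normSq_eq_norm_sq]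

variable {H}

lemma isUnit_det_gram (hH : IsUnit (H.conjTranspose * H)) : IsUnit (H.conjTranspose * H).det :=
  (Matrix.isUnit_iff_isUnit_det _).1 hH

lemma gram_mulVec_neSolution (hH : IsUnit (H.conjTranspose * H)) (x : Fin K → ℂ) :
    (H.conjTranspose * H).mulVec (neSolution H x) = x := by
  rw [neSolution, Matrix.mulVec_mulVec, Matrix.mul_nonsing_inv _ (isUnit_det_gram hH),
    Matrix.one_mulVec]

/-- Coercivity without eigenvalues: for `e = (Hᴴ H)⁻¹ z`, Cauchy–Schwarz gives `‖z‖² = ⟨H e, H z⟩ ≤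
‖H e‖ ‖H z‖` and `‖H e‖² = ⟨e, z⟩ ≤ ν ‖z‖²`. Square the first, insert the second and cancel `‖z‖²`.
-/
lemma vecNorm_sq_le_quadForm (hH : IsUnit (H.conjTranspose * H)) (z : Fin K → ℂ) :
    vecNorm z ^ 2 ≤ specNorm (H.conjTranspose * H)⁻¹
      * (star z ⬝ᵥ (H.conjTranspose * H).mulVec z).re := by
  set ν := specNorm (H.conjTranspose * H)⁻¹
  have hν0 : 0 ≤ ν := specNorm_nonneg _
  rw [quadForm_gram, Complex.ofReal_re]
  set e := neSolution H z with he
  have hz := gram_mulVec_neSolution hH z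
  rw [← he] at hz
  have h1 : vecNorm (H.mulVec e) ^ 2 ≤ ν * vecNorm z ^ 2 := by
    have h2 : ((vecNorm (H.mulVec e) ^ 2 : ℝ) : ℂ) = ∑ i, star (e i) * z i := by
      rw [← quadForm_gram, hz]; rfl
    have h3 := norm_sum_star_mul_le e z
    rw [← h2, Complex.norm_real, Real.norm_of_nonneg (sq_nonneg _)] at h3
    have h4 := mul_le_mul_of_nonneg_right
      (vecNorm_mulVec_le (H.conjTranspose * H)⁻¹ z) (vecNorm_nonneg z)
    change vecNorm e * vecNorm z ≤ _ at h4
    linarith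
  have h5 : vecNorm z ^ 2 ≤ vecNorm (H.mulVec e) * vecNorm (H.mulVec z) := by
    have h2 : ((vecNorm z ^ 2 : ℝ) : ℂ)
        = ∑ i, star (H.mulVec e i) * H.mulVec z i := by
      have : (∑ i, star (H.mulVec e i) * H.mulVec z i) = star (H.mulVec e) ⬝ᵥ H.mulVec z := rfl
      rw [this, Matrix.star_mulVec, ← Matrix.dotProduct_mulVec, Matrix.mulVec_mulVec,
        Matrix.dotProduct_mulVec, ← (Matrix.isHermitian_conjTranspose_mul_self H).eq,
        ← Matrix.star_mulVec, hz, vecNorm_sq, Complex.ofReal_sum, dotProduct]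
      refine Finset.sum_congr rfl fun k _ => ?_
      rw [Pi.star_apply, Complex.star_def, mul_comm, Complex.mul_conj, Complex.normSq_eq_norm_sq]
    have h3 := norm_sum_star_mul_le (H.mulVec e) (H.mulVec z)
    rwa [← h2, Complex.norm_real, Real.norm_of_nonneg (sq_nonneg _)] at h3
  have h6 : vecNorm z ^ 2 * vecNorm z ^ 2
      ≤ vecNorm z ^ 2 * (ν * vecNorm (H.mulVec z) ^ 2) := by
    calc vecNorm z ^ 2 * vecNorm z ^ 2
        ≤ (vecNorm (H.mulVec e) * vecNorm (H.mulVec z))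
          * (vecNorm (H.mulVec e) * vecNorm (H.mulVec z)) :=
          mul_le_mul h5 h5 (sq_nonneg _)
            (mul_nonneg (vecNorm_nonneg _) (vecNorm_nonneg _))
      _ = vecNorm (H.mulVec e) ^ 2 * vecNorm (H.mulVec z) ^ 2 := by ring
      _ ≤ ν * vecNorm z ^ 2 * vecNorm (H.mulVec z) ^ 2 :=
          mul_le_mul_of_nonneg_right h1 (sq_nonneg _)
      _ = _ := by ring
  rcases (sq_nonneg (vecNorm z)).eq_or_lt with h | h
  · rw [← h]; exact mul_nonneg hν0 (sq_nonneg _)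
  · exact le_of_mul_le_mul_left h6 h

lemma card_le_of_isUnit_gram (hH : IsUnit (H.conjTranspose * H)) : K ≤ M := by
  have h1 := Matrix.rank_of_isUnit _ hH
  have h3 := Matrix.rank_mul_le_right H.conjTranspose H
  rw [Fintype.card_fin] at h1
  have h2 := H.rank_le_card_height
  rw [Fintype.card_fin] at h2
  omega

lemma cond2_gram : cond2 (H.conjTranspose * H)
    = specNorm H ^ 2 * specNorm (H.conjTranspose * H)⁻¹ := by
  rw [cond2, specNorm_gram]

lemma one_le_cond2_gram (hK : 0 < K) (hH : IsUnit (H.conjTranspose * H)) :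
    1 ≤ cond2 (H.conjTranspose * H) := by
  have h1 := vecNorm_sq_le_quadForm hH (Pi.single ⟨0, hK⟩ 1)
  rw [quadForm_gram, Complex.ofReal_re, vecNorm_single] at h1
  have h2 := vecNorm_mulVec_le H (Pi.single ⟨0, hK⟩ 1)
  rw [vecNorm_single, mul_one] at h2
  have h3 := mul_le_mul_of_nonneg_left (pow_le_pow_left₀ (vecNorm_nonneg _) h2 2)
    (specNorm_nonneg (H.conjTranspose * H)⁻¹)
  rw [cond2_gram]
  linarith

end Gram

/-! ### The constants of the bound -/

/-- From `exp y ≥ 1 + y`, dropping the second-order term. All later lower bounds on the `γ`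
constants rest on this one. -/
lemma mul_sqrt_mul_le_gam {lam u : ℝ} (hu1 : u < 1) (n : ℕ) :
    lam * Real.sqrt n * u ≤ gam lam u n := by
  have h1 : 0 ≤ (n : ℝ) * u ^ 2 / (1 - u) := div_nonneg (by positivity) (by linarith)
  have h2 := Real.add_one_le_exp (lam * Real.sqrt n * u + n * u ^ 2 / (1 - u))
  rw [gam]
  linarith

lemma gam_nonneg {lam u : ℝ} (hl : 0 < lam) (hu : 0 < u) (hu1 : u < 1) (n : ℕ) :
    0 ≤ gam lam u n :=
  le_trans (by positivity) (mul_sqrt_mul_le_gam hu1 n)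

/-- The denominator in `c1` lies in `(0, 1]`, so dropping it only decreases the value. -/
lemma two_mul_add_gam_le_c1 {M K : ℕ} {lam u : ℝ} (hl : 0 < lam) (hu : 0 < u) (hu1 : u < 1)
    (h : 2 * K * gam lam u (2 * K + 1) < 1) :
    2 * K * (gam lam u (2 * M) + gam lam u (6 * K + 1)) ≤ c1 M K lam u := by
  have h1 := gam_nonneg hl hu hu1 (6 * K + 1)
  have h2 := gam_nonneg hl hu hu1 (2 * K + 1)
  have h3 : 0 ≤ 2 * (K : ℝ) * gam lam u (2 * K + 1) := by positivity
  rw [c1]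
  refine mul_le_mul_of_nonneg_left (add_le_add_right ?_ _) (by positivity)
  rw [le_div_iff₀ (by linarith)]
  nlinarith

lemma mul_sqrt_two_mul_le_gam {lam u : ℝ} (hl : 0 < lam) (hu : 0 < u) (hu1 : u < 1) (K : ℕ) :
    lam * Real.sqrt (2 * K : ℕ) * u ≤ gam lam u (6 * K + 1) := by
  refine le_trans ?_ (mul_sqrt_mul_le_gam hu1 _)
  have : Real.sqrt (2 * K : ℕ) ≤ Real.sqrt (6 * K + 1 : ℕ) :=
    Real.sqrt_le_sqrt (by exact_mod_cast (by omega : 2 * K ≤ 6 * K + 1))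
  gcongr

/-- The tolerance of a sum of `n` terms dominates the unit roundoff and the second-order terms. -/
lemma tolerance_bounds {l lam u τ : ℝ} {n : ℕ} (hl : 1 ≤ l) (hlam : lam = 1000 * τ * l)
    (hτ : 1 ≤ τ) (hn : 1 ≤ n) (hu : 0 < u) (h : lam * Real.sqrt n * u ≤ 1 / 2) :
    l * Real.sqrt n * u ≤ 1 / 100 ∧ u ≤ l * Real.sqrt n * u ∧
      n * u ^ 2 ≤ l * Real.sqrt n * u := by
  have hs : 1 ≤ Real.sqrt n := Real.one_le_sqrt.2 (by exact_mod_cast hn)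
  obtain ⟨y, hy⟩ : ∃ y, y = Real.sqrt n * u := ⟨_, rfl⟩
  have hy0 : 0 < y := by rw [hy]; positivity
  have huy : u ≤ y := by rw [hy]; nlinarith
  have hly : l * Real.sqrt n * u = l * y := by rw [hy]; ring
  have hlamy : lam * Real.sqrt n * u = lam * y := by rw [hy]; ring
  have hny : n * u ^ 2 = y ^ 2 := by
    rw [hy, mul_pow, Real.sq_sqrt (Nat.cast_nonneg n)]
  have hyl : y ≤ l * y := by nlinarith
  have h1 : 1000 * (l * y) ≤ lam * y := by
    rw [hlam]
    have : 0 ≤ (τ - 1) * (l * y) := mul_nonneg (by linarith) (by linarith)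
    linarith
  rw [hly, hny]
  rw [hlamy] at h
  refine ⟨by linarith, by linarith, ?_⟩
  nlinarith

/-! ### The transmit vector -/

/-- Relative error of the computed transmit vector when all rounding errors are small. -/
lemma vecNorm_flMulVec_flNESolution_sub_le {M K : ℕ} {δ : RoundOp → ℝ} {s t τ η θ : ℝ}
    (h : SmallSample δ M K s t) (hs0 : 0 ≤ s) (ht0 : 0 ≤ t) (hst : 20 * (s + t) ≤ 1 / 10)
    {H : Matrix (Fin M) (Fin K) ℂ} (hH : IsUnit (H.conjTranspose * H)) (x : Fin K → ℂ)
    (hτ : specNorm H * vecNorm (neSolution H x) ≤ τ * vecNorm (H.mulVec (neSolution H x)))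
    (hη : 160 * (s + t) * K * cond2 (H.conjTranspose * H) ≤ η) (hη1 : η ≤ 1 / 2)
    (hητ : 2 * η * τ ≤ θ) :
    vecNorm (flMulVec δ .product H (flNESolution δ H x) - H.mulVec (neSolution H x))
      ≤ (θ + 40 * t * τ * Real.sqrt K) * vecNorm (H.mulVec (neSolution H x)) := by
  set ν := specNorm (H.conjTranspose * H)⁻¹ with hν
  have hν0 : 0 ≤ ν := specNorm_nonneg _
  set T := Real.sqrt K * specNorm H with hT
  have hT0 : 0 ≤ T := mul_nonneg (Real.sqrt_nonneg _) (specNorm_nonneg H)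
  have hTν : T ^ 2 * ν = K * cond2 (H.conjTranspose * H) := by
    rw [hT, mul_pow, Real.sq_sqrt (Nat.cast_nonneg K), cond2_gram]; ring
  -- Here `160 = 8 * 20` comes from the residual bound. Excluding breakdown needs only `7 * 20 =
  -- 140`, so `η ≤ 1 / 2` covers both.
  have hη' : 160 * (s + t) * (T ^ 2 * ν) ≤ η := by rw [hTν]; linarith
  have hη0 : 0 ≤ 160 * (s + t) * (T ^ 2 * ν) := by positivity
  have hres := vecNorm_flNESolution_residual_le h hs0 ht0 hst H x hT0 (sum_vecNorm_col_sq_le H) hν0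
    (vecNorm_sq_le_quadForm hH) (by linarith)
  set e := flNESolution δ H x with he
  set e₀ := neSolution H x with he₀
  have hdiff : e - e₀ = (H.conjTranspose * H)⁻¹.mulVec ((H.conjTranspose * H).mulVec e - x) := by
    rw [Matrix.mulVec_sub, Matrix.mulVec_mulVec, Matrix.nonsing_inv_mul _ (isUnit_det_gram hH),
      Matrix.one_mulVec, he₀, neSolution]
  have hn := vecNorm_nonneg e
  have hn₀ := vecNorm_nonneg e₀
  have h1 : vecNorm (e - e₀) ≤ η * vecNorm e := by
    have h2 := vecNorm_mulVec_le (H.conjTranspose * H)⁻¹ ((H.conjTranspose * H).mulVec e - x)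
    rw [← hdiff] at h2
    have h3 := mul_le_mul_of_nonneg_left hres hν0
    have h4 := mul_le_mul_of_nonneg_right hη' hn
    linarith
  -- Absorption: `‖e‖ ≤ ‖e₀‖ + η ‖e‖` with `η ≤ 1 / 2`.
  have h2 : vecNorm e ≤ 2 * vecNorm e₀ := by
    have h3 := vecNorm_add_le (e - e₀) e₀
    rw [sub_add_cancel] at h3
    have h4 := mul_le_mul_of_nonneg_right hη1 hn
    linarith
  have hη00 : 0 ≤ η := hη0.trans hη'
  set Y := vecNorm (H.mulVec e₀) with hY
  have hY0 : 0 ≤ Y := vecNorm_nonneg _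
  have h3 : vecNorm (H.mulVec (e - e₀)) ≤ θ * Y := by
    calc vecNorm (H.mulVec (e - e₀)) ≤ specNorm H * vecNorm (e - e₀) := vecNorm_mulVec_le H _
      _ ≤ specNorm H * (η * (2 * vecNorm e₀)) :=
          mul_le_mul_of_nonneg_left (h1.trans (mul_le_mul_of_nonneg_left h2 hη00))
            (specNorm_nonneg H)
      _ = 2 * η * (specNorm H * vecNorm e₀) := by ring
      _ ≤ 2 * η * (τ * Y) := mul_le_mul_of_nonneg_left hτ (by linarith)
      _ = 2 * η * τ * Y := by ring
      _ ≤ θ * Y := mul_le_mul_of_nonneg_right hητ hY0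
  have h4 : vecNorm (flMulVec δ .product H e - H.mulVec e) ≤ 40 * t * τ * Real.sqrt K * Y := by
    calc _ ≤ 20 * t * T * vecNorm e :=
          vecNorm_flMulVec_sub_le h ht0 H hT0 (sum_vecNorm_col_sq_le H) e
      _ ≤ 20 * t * T * (2 * vecNorm e₀) := mul_le_mul_of_nonneg_left h2 (by positivity)
      _ = 40 * t * Real.sqrt K * (specNorm H * vecNorm e₀) := by rw [hT]; ring
      _ ≤ 40 * t * Real.sqrt K * (τ * Y) := mul_le_mul_of_nonneg_left hτ (by positivity)
      _ = _ := by ring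
  have h5 : flMulVec δ .product H e - H.mulVec e₀
      = (flMulVec δ .product H e - H.mulVec e) + H.mulVec (e - e₀) := by
    rw [Matrix.mulVec_sub]; abel
  rw [h5]
  refine (vecNorm_add_le _ _).trans ?_
  linarith

lemma smallSample_of_notMem_badEvent {Ω : Type*} [MeasurableSpace Ω] {P : Measure Ω} {u : ℝ}
    {δ : RoundOp → Ω → ℝ} (h : RoundingModel P u δ) (hu : 0 < u) {M K : ℕ} {l s t : ℝ} {ω : Ω}
    (hω : ω ∉ badEvent δ u l M K)
    (hs : l * Real.sqrt (2 * M : ℕ) * u = s) (ht : l * Real.sqrt (2 * K : ℕ) * u = t)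
    (hs1 : s ≤ 1 / 100 ∧ u ≤ s ∧ (2 * M : ℕ) * u ^ 2 ≤ s)
    (ht1 : t ≤ 1 / 100 ∧ u ≤ t ∧ (2 * K : ℕ) * u ^ 2 ≤ t) :
    SmallSample (fun o => δ o ω) M K s t := by
  simp only [badEvent, Set.mem_union, Set.mem_iUnion, Finset.mem_range, not_or, not_exists] at hω
  obtain ⟨⟨⟨⟨h1, h2⟩, h3⟩, h4⟩, h5⟩ := hω
  obtain ⟨s1, s2, s3⟩ := hs1
  obtain ⟨t1, t2, t3⟩ := ht1
  exact
    { gram := fun i hi j hj =>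
        smallErrors_of_notMem_largePrefix h hu (h1 i hi j hj) hs s1 s2 s3
      chol := fun i hi j hj =>
        smallErrors_of_notMem_largePrefix h hu (h2 i hi j hj) ht t1 t2 t3
      forward := fun i hi =>
        smallErrors_of_notMem_largePrefix h hu (h3 i hi 0 one_pos) ht t1 t2 t3
      backward := fun i hi =>
        smallErrors_of_notMem_largePrefix h hu (h4 i hi 0 one_pos) ht t1 t2 t3
      product := fun i hi =>
        smallErrors_of_notMem_largePrefix h hu (h5 i hi 0 one_pos) ht t1 t2 t3 }

/-- Outside the bad event with parameter `l = λ / (1000 τ) ≥ 1` the error bound holds. -/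
lemma vecNorm_flTransmit_sub_le {Ω : Type*} [MeasurableSpace Ω] {P : Measure Ω} {u : ℝ}
    {δ : RoundOp → Ω → ℝ} (h : RoundingModel P u δ) (hu : 0 < u) (hu1 : u < 1) {M K : ℕ}
    (hK : 0 < K) {H : Matrix (Fin M) (Fin K) ℂ} (hH : IsUnit (H.conjTranspose * H))
    (x : Fin K → ℂ) (β : ℝ) {lam τ l : ℝ} (hlam : 0 < lam)
    (hγ : 2 * K * gam lam u (2 * K + 1) < 1)
    (hc : c1 M K lam u * cond2 (H.conjTranspose * H) < 1) (hτ1 : 1 ≤ τ)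
    (hτ : specNorm H * vecNorm (neSolution H x) ≤ τ * vecNorm (H.mulVec (neSolution H x)))
    (hl : 1 ≤ l) (hll : lam = 1000 * τ * l) {ω : Ω} (hω : ω ∉ badEvent δ u l M K) :
    vecNorm (flTransmit (fun o => δ o ω) β H x - zfTransmit β H x)
      ≤ cd H lam u * vecNorm (zfTransmit β H x) := by
  have hM : 0 < M := hK.trans_le (card_le_of_isUnit_gram hH)
  set κ := cond2 (H.conjTranspose * H) with hκ
  have hκ1 : 1 ≤ κ := one_le_cond2_gram hK hH
  have hK1 : (1 : ℝ) ≤ K := by exact_mod_cast hK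
  have hc1 := two_mul_add_gam_le_c1 (M := M) hlam hu hu1 hγ
  have g1 := gam_nonneg hlam hu hu1 (2 * M)
  have g2 := gam_nonneg hlam hu hu1 (6 * K + 1)
  set γ := gam lam u (2 * M) + gam lam u (6 * K + 1) with hγdef
  have hγ0 : 0 ≤ γ := add_nonneg g1 g2
  have hc1κ : 2 * K * γ * κ ≤ c1 M K lam u * κ := mul_le_mul_of_nonneg_right hc1 (by linarith)
  have hKκ : 1 ≤ K * κ := one_le_mul_of_one_le_of_one_le hK1 hκ1
  -- Since `2 K γ κ ≤ c₁ κ < 1` and `K κ ≥ 1`; this makes the tolerances small enough for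
  -- `tolerance_bounds`.
  have hγ2 : γ ≤ 1 / 2 := by
    have : γ * 1 ≤ γ * (K * κ) := mul_le_mul_of_nonneg_left hKκ hγ0
    linarith
  have b1 := mul_sqrt_mul_le_gam (lam := lam) hu1 (2 * M)
  have b2 := mul_sqrt_two_mul_le_gam hlam hu hu1 K
  have b3 := mul_sqrt_mul_le_gam (lam := lam) hu1 (2 * K)
  obtain ⟨s, hs⟩ : ∃ s, l * Real.sqrt (2 * M : ℕ) * u = s := ⟨_, rfl⟩
  obtain ⟨t, ht⟩ : ∃ t, l * Real.sqrt (2 * K : ℕ) * u = t := ⟨_, rfl⟩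
  have hsτ : lam * Real.sqrt (2 * M : ℕ) * u = 1000 * τ * s := by rw [hll, ← hs]; ring
  have htτ : lam * Real.sqrt (2 * K : ℕ) * u = 1000 * τ * t := by rw [hll, ← ht]; ring
  have hs1 := tolerance_bounds hl hll hτ1 (by omega : 1 ≤ 2 * M) hu (by linarith)
  have ht1 := tolerance_bounds hl hll hτ1 (by omega : 1 ≤ 2 * K) hu (by linarith)
  rw [hs] at hs1
  rw [ht] at ht1
  have hsmall := smallSample_of_notMem_badEvent h hu hω hs ht hs1 ht1
  have hs0 : 0 ≤ s := hu.le.trans hs1.2.1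
  have ht0 : 0 ≤ t := hu.le.trans ht1.2.1
  have hstτ : 1000 * τ * (s + t) ≤ γ := by linarith
  have hst : s + t ≤ 1 / 2000 := by
    have : 0 ≤ (τ - 1) * (s + t) := mul_nonneg (by linarith) (by linarith)
    linarith
  -- The slack `1000 τ` pays here: `320 τ (s + t) ≤ γ`, while `c1` contains `2 K γ`.
  have hητ : 2 * (160 * (s + t) * K * κ) * τ ≤ c1 M K lam u * κ := by
    have h1 := mul_le_mul_of_nonneg_right hstτ (by linarith : 0 ≤ K * κ)
    have h2 : 0 ≤ γ * (K * κ) := mul_nonneg hγ0 (by linarith)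
    linarith
  have hη1 : 160 * (s + t) * K * κ ≤ 1 / 2 := by
    have : 0 ≤ (τ - 1) * (160 * (s + t) * K * κ) :=
      mul_nonneg (by linarith) (by positivity)
    linarith
  have hmain := vecNorm_flMulVec_flNESolution_sub_le hsmall hs0 ht0 (by linarith) hH x hτ le_rfl
    hη1 hητ
  have hsq : Real.sqrt K ≤ Real.sqrt (2 * K) := Real.sqrt_le_sqrt (by linarith)
  have hcd : c1 M K lam u * κ + 40 * t * τ * Real.sqrt K ≤ cd H lam u := by
    have h1 : 0 ≤ c1 M K lam u * κ := le_trans (by positivity) hc1κ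
    have g3 := gam_nonneg hlam hu hu1 (2 * K)
    have h2 : 40 * t * τ ≤ gam lam u (2 * K) := by
      have : 0 ≤ t * τ := mul_nonneg ht0 (by linarith)
      linarith
    have h3 : 40 * t * τ * Real.sqrt K ≤ gam lam u (2 * K) * Real.sqrt (2 * K) :=
      mul_le_mul h2 hsq (Real.sqrt_nonneg _) g3
    have h4 : 0 ≤ Real.sqrt (2 * K) * gam lam u (2 * K) * (c1 M K lam u * κ) := by positivity
    rw [cd]
    linarith
  have hdiff : flTransmit (fun o => δ o ω) β H x - zfTransmit β H x
      = ((Real.sqrt β : ℝ) : ℂ) • (flMulVec (fun o => δ o ω) .product H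
        (flNESolution (fun o => δ o ω) H x) - H.mulVec (neSolution H x)) := by
    rw [flTransmit, zfTransmit, smul_sub]
  rw [hdiff, zfTransmit, vecNorm_smul, vecNorm_smul]
  calc _ ≤ ‖((Real.sqrt β : ℝ) : ℂ)‖ * (cd H lam u * vecNorm (H.mulVec (neSolution H x))) :=
        mul_le_mul_of_nonneg_left
          (hmain.trans (mul_le_mul_of_nonneg_right hcd (vecNorm_nonneg _))) (norm_nonneg _)
    _ = _ := by ring

/-- The users receive the scaled data, the propagated perturbation of the transmit vector and the
noise. -/
lemma received_zfTransmit_add {M K : ℕ} {H : Matrix (Fin M) (Fin K) ℂ}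
    (hH : IsUnit (H.conjTranspose * H)) (x : Fin K → ℂ) (β : ℝ) {ρ : ℝ} (hρ : 0 ≤ ρ)
    (d : Fin M → ℂ) (noise : Fin K → ℂ) (k : Fin K) :
    received ρ H (zfTransmit β H x + d) noise k
      = ((Real.sqrt (ρ * β) : ℝ) : ℂ) * x k
        + ((Real.sqrt ρ : ℝ) : ℂ) * (∑ m, star (H m k) * d m) + noise k := by
  have h1 : H.conjTranspose.mulVec (zfTransmit β H x) = ((Real.sqrt β : ℝ) : ℂ) • x := by
    rw [zfTransmit, Matrix.mulVec_smul, Matrix.mulVec_mulVec, gram_mulVec_neSolution hH]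
  have h2 : H.conjTranspose.mulVec d k = ∑ m, star (H m k) * d m := rfl
  rw [received, Matrix.mulVec_add, h1, Real.sqrt_mul hρ]
  simp only [Pi.add_apply, Pi.smul_apply, smul_eq_mul, h2, Complex.ofReal_mul]
  ring

/-- Subadditivity on the cover by `A` and `B`; passing to complements would require measurability.
-/
lemma one_sub_measureReal_le {Ω : Type*} [MeasurableSpace Ω] {P : Measure Ω}
    [IsProbabilityMeasure P] {A B : Set Ω} (h : ∀ ω, ω ∉ B → ω ∈ A) :
    1 - P.real B ≤ P.real A := by
  have h1 : P.real Set.univ ≤ P.real (A ∪ B) := measureReal_mono fun ω _ => by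
    by_cases hB : ω ∈ B
    · exact Or.inr hB
    · exact Or.inl (h ω hB)
  rw [probReal_univ] at h1
  linarith [measureReal_union_le (μ := P) A B]

end ZFPrecoding

end

/-! ### Choice of the absolute constants and conclusion. -/

open ZFPrecoding in
theorem lemma5 :
    ∃ C c : ℝ, 0 < C ∧ 0 < c ∧
      ∀ (M K : ℕ) (_ : 0 < K) (H : Matrix (Fin M) (Fin K) ℂ)
        (_ : IsUnit (H.conjTranspose * H)) (x : Fin K → ℂ)
        (β : ℝ) (_ : 0 ≤ β) (u lam : ℝ) (_ : 0 < u) (_ : u < 1) (_ : 0 < lam)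
        (_ : 2 * K * gam lam u (2 * K + 1) < 1)
        (_ : c1 M K lam u * cond2 (H.conjTranspose * H) < 1)
        (τ : ℝ) (_ : 1 ≤ τ)
        (_ : specNorm H * vecNorm (neSolution H x) ≤ τ * vecNorm (H.mulVec (neSolution H x)))
        (Ω : Type*) (_ : MeasurableSpace Ω) (P : MeasureTheory.Measure Ω)
        (_ : MeasureTheory.IsProbabilityMeasure P) (δ : RoundOp → Ω → ℝ)
        (_ : RoundingModel P u δ),
        ∃ ΔS : Ω → Fin M → ℂ,
          (∀ ω, flTransmit (fun o => δ o ω) β H x = zfTransmit β H x + ΔS ω) ∧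
          (∀ ω (ρ : ℝ) (_ : 0 ≤ ρ) (noise : Fin K → ℂ) (k : Fin K),
            received ρ H (flTransmit (fun o => δ o ω) β H x) noise k
              = ((Real.sqrt (ρ * β) : ℝ) : ℂ) * x k
                + ((Real.sqrt ρ : ℝ) : ℂ) * (∑ m, star (H m k) * ΔS ω m) + noise k) ∧
          1 - C * (M * K ^ 2) * Real.exp (-c * (lam / τ) ^ 2)
            ≤ P.real {ω | vecNorm (ΔS ω) ≤ cd H lam u * vecNorm (zfTransmit β H x)} := by
  -- `40` is the constant of the union bound; the second constant makes the exponent equal to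
  -- `-l²/2` for `l = λ / (1000 τ)`.
  refine ⟨40, 1 / (2 * 1000 ^ 2), by norm_num, by norm_num, ?_⟩
  intro M K hK H hH x β _ u lam hu hu1 hlam hγ hc τ hτ1 hτ Ω _ P _ δ hδ
  refine ⟨fun ω => flTransmit (fun o => δ o ω) β H x - zfTransmit β H x,
    fun ω => (add_sub_cancel _ _).symm, fun ω ρ hρ noise k => ?_, ?_⟩
  · rw [← received_zfTransmit_add hH x β hρ, add_sub_cancel]
  have hKM := card_le_of_isUnit_gram hH
  set l := lam / (1000 * τ) with hl
  have hll : lam = 1000 * τ * l := by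
    rw [hl, mul_div_cancel₀ _ (by positivity : (1000 * τ : ℝ) ≠ 0)]
  have hl0 : 0 < l := by positivity
  have hexp : -(1 / (2 * 1000 ^ 2)) * (lam / τ) ^ 2 = -(l ^ 2 / 2) := by
    rw [hl]; field_simp
  rw [hexp]
  -- For `l < 1` the exponential is at least `1 / 2`, so the claimed lower bound is negative. For `l
  -- ≥ 1` the tolerances dominate `u`, as the error analysis requires.
  rcases lt_or_ge l 1 with h1 | h1
  · have hMK : (1 : ℝ) ≤ M * K ^ 2 := by
      have : 0 < M * K ^ 2 := Nat.mul_pos (hK.trans_le hKM) (pow_pos hK 2)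
      exact_mod_cast this
    have h2 : (1 : ℝ) / 2 ≤ Real.exp (-(l ^ 2 / 2)) := by
      have := Real.add_one_le_exp (-(l ^ 2 / 2))
      nlinarith
    have h3 : (1 : ℝ) * (1 / 2) ≤ M * K ^ 2 * Real.exp (-(l ^ 2 / 2)) :=
      mul_le_mul hMK h2 (by norm_num) (by linarith)
    exact le_trans (by linarith) MeasureTheory.measureReal_nonneg
  · refine le_trans (sub_le_sub_left (hδ.measureReal_badEvent_le hu hl0.le hK hKM) 1)
      (one_sub_measureReal_le fun ω hω => ?_)
    exact vecNorm_flTransmit_sub_le hδ hu hu1 hK hH x β hlam hγ hc hτ1 hτ h1 hll hω
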